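/- Let $D\subset\mathbb R^2$ be a bounded Lipschitz domain (open, connected), let $\mathbf s=(\mathbf s_1,\dots,\mathbf s_N)\in(\mathbb R^2)^N$ be seed points, $\bm\psi=(\psi_1,\dots,\psi_N)\in\mathbb R^N$ weights and $\bm\nu\in\mathbb R^N$ an arbitrary vector. For $i=1,\dots,N$ define the modified Laguerre cells $$V_i(\mathbf s,\bm\psi)=\{\mathbf x\in\overline D:\ |\mathbf x-\mathbf s_i|^2\le\psi_i\ \text{ and }\ |\mathbf x-\mathbf s_i|^2-\psi_i\le|\mathbf x-\mathbf s_j|^2-\psi_j\ \ \forall j\ne i\},$$ and the void cell $V_0(\mathbf s,\bm\psi)=\{\mathbf x\in\overline D:\ |\mathbf x-\mathbf s_i|^2-\psi_i\ge 0\ \ \forall i=1,\dots,N\}$. The Kantorovic functional is $$K(\mathbf s,\bm\nu,\bm\psi)=\sum_{i=1}^N\int_{V_i(\mathbf s,\bm\psi)}\big(|\mathbf x-\mathbf s_i|^2-\psi_i\big)\,d\mathbf x+\sum_{i=1}^N\nu_i\psi_i,$$ and $\mathbf F(\mathbf s,\bm\nu,\bm\psi)=\nabla_{\bm\psi}K(\mathbf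 s,\bm\nu,\bm\psi)\in\mathbb R^N$. Two cells $V_i,V_j$ with $i\ne j$ in $\{1,\dots,N\}$ are neighbors if $V_i\cap V_j$ has positive length; then $\mathbf e_{ij}=V_i\cap V_j$ is their common edge. The pieces of the boundary of $V_i$ are the edges $\mathbf e_{ij}$ with the neighbors $V_j$ of $V_i$, the set of circular arcs $\mathcal C_i=V_i\cap V_0$, and $\mathcal L_i=V_i\cap\partial D$. A vertex of the diagram is a point at which two different pieces of the boundary of the same cell $V_i$, $i\in\{1,\dots,N\}$, meet. Assume the following genericity conditions. - (G1) All the cells $V_0,V_1,\dots,V_N$ have positive Lebesgue measure. - (G2) For pairwise different indices $i,j,k$, the points $\mathbf s_i,\mathbf s_j,\mathbf s_k$ are not aligned. - (G3) For each vertex $\mathbf q$ at the intersection of two neighboring cells $V_i,V_j$ $(i,j\ge1)$ and the void $V_0$, the points $\mathbf q,\mathbf s_i,\mathbf s_j$ are not aligned. - (G4) Each vertex belongs to at most 3 of the cells $V_0,\dots,V_N$. - (G5) At each vertex $\mathbf q\in\partial D$, the boundary $\partial D$ is smooth (of class $C^1$ near $\mathbf q$), with unit outward normal vector $\mathbf n(\mathbf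 q)$, and $\mathbf q$ belongs to at most 2 of the cells $V_0,\dots,V_N$. - (G6) For each vertex $\mathbf q$ at the intersection of $\partial D$ and two distinct cells $V_i,V_j$ $(i,j\ge1)$, the line $\{\mathbf x:\ |\mathbf x-\mathbf s_i|^2-\psi_i=|\mathbf x-\mathbf s_j|^2-\psi_j\}$ carrying their common boundary is not orthogonal to $\mathbf n(\mathbf q)$. - (G7) For each vertex $\mathbf q$ at the intersection of $\partial D$, a cell $V_i$ $(i\ge1)$ and the void $V_0$, the line $\mathbf q\mathbf s_i$ is not parallel to $\mathbf n(\mathbf q)$ (that is, the circle bounding $V_i$ is not tangent to $\partial D$ at $\mathbf q$). Then $K(\mathbf s,\bm\nu,\cdot)$ is differentiable in a neighborhood of $\bm\psi$, the map $\mathbf F(\mathbf s,\bm\nu,\cdot)$ is differentiable at $\bm\psi$, and the $N\times N$ matrix $$\nabla_{\bm\psi}\mathbf F(\mathbf s,\bm\nu,\bm\psi)=\left[\frac{\partial F_i}{\partial\psi_j}(\mathbf s,\bm\nu,\bm\psi)\right]_{i,j=1,\dots,N}$$ is (symmetric) negative definite. In particular it is invertible. -/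

import Mathlib

open MeasureTheory Topology
open scoped NNReal

namespace ModLaguerre

/-- The Euclidean plane `ℝ²`. -/
abbrev Plane : Type := EuclideanSpace ℝ (Fin 2)

/-- A bounded Lipschitz domain of the plane: a bounded, connected, non-empty open set which, near
each of its boundary points `p`, is the strict subgraph of a Lipschitz function in the coordinates
of some orthonormal frame with origin `p`. -/
structure IsLipschitzDomain (D : Set Plane) : Prop where
  isOpen : IsOpen D
  isConnected : IsConnected D
  isBounded : Bornology.IsBounded D
  locally_subgraph : ∀ p ∈ frontier D,
    ∃ (b : OrthonormalBasis (Fin 2) ℝ Plane) (L : ℝ≥0) (γ : ℝ → ℝ), LipschitzWith L γ ∧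
      ∀ᶠ x in 𝓝 p, (x ∈ D ↔ b.repr (x - p) 1 < γ (b.repr (x - p) 0))

/-- `∂D` is of class `C¹` in a neighbourhood of its point `q`, with unit outward normal vector `n`
at `q`: near `q`, the set `D` is the negative set of a level set function `φ` of class `C¹`
with `∇φ(q) ≠ 0`, and `n = ∇φ(q) / |∇φ(q)|`. -/
def IsOutwardNormal (D : Set Plane) (q n : Plane) : Prop :=
  q ∈ frontier D ∧ ∃ φ : Plane → ℝ, ContDiffAt ℝ 1 φ q ∧ gradient φ q ≠ 0 ∧
    (∀ᶠ x in 𝓝 q, (x ∈ D ↔ φ x < 0)) ∧ n = ‖gradient φ q‖⁻¹ • gradient φ q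

section Diagram

variable {N : ℕ} (D : Set Plane) (s : Fin N → Plane) (ψ : EuclideanSpace ℝ (Fin N))

/-- The (classical) Laguerre cell `Lag_i(s, ψ)`. -/
def lagCell (i : Fin N) : Set Plane :=
  {x | x ∈ closure D ∧ ∀ j, j ≠ i → ‖x - s i‖ ^ 2 - ψ i ≤ ‖x - s j‖ ^ 2 - ψ j}

/-- The modified cell `V_i(s, ψ)`, `i = 1, …, N`: the intersection of `Lag_i(s, ψ)` with the closed
disc with center `s i` and radius `(ψ i)^(1/2)` (which is empty if `ψ i < 0`). -/
def cell (i : Fin N) : Set Plane :=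
  lagCell D s ψ i ∩ {x | ‖x - s i‖ ^ 2 ≤ ψ i}

/-- The void cell `V_0(s, ψ)`. -/
def voidCell : Set Plane :=
  {x | x ∈ closure D ∧ ∀ i, 0 ≤ ‖x - s i‖ ^ 2 - ψ i}

/-- All the cells of the diagram: `none` stands for the index `0` of the void cell,
and `some i` for the index `i = 1, …, N`. -/
def anyCell : Option (Fin N) → Set Plane
  | none => voidCell D s ψ
  | some i => cell D s ψ i

/-- `V_i` and `V_j` are neighbors: their intersection has positive length. -/
def IsNeighbor (i j : Fin N) : Prop :=
  i ≠ j ∧ 0 < μH[1] (cell D s ψ i ∩ cell D s ψ j)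

/-- The common edge `e_ij` of `V_i` and `V_j`. -/
def edge (i j : Fin N) : Set Plane := cell D s ψ i ∩ cell D s ψ j

/-- The circular arcs `C_i` in the boundary of `V_i`, along which `V_i` meets the void. -/
def arcs (i : Fin N) : Set Plane := cell D s ψ i ∩ voidCell D s ψ

/-- The part `L_i` of the boundary of `V_i` that lies on `∂D`. -/
def outer (i : Fin N) : Set Plane := cell D s ψ i ∩ frontier D

/-- The vertices of the diagram, i.e. the endpoints of the pieces of the decomposition
`∂V_i = (⋃_{j neighbor of i} e_ij) ∪ C_i ∪ L_i`: the points where two different pieces of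
the boundary of the same cell meet. -/
def IsVertex (q : Plane) : Prop :=
  ∃ i : Fin N,
    (∃ j k, j ≠ k ∧ IsNeighbor D s ψ i j ∧ IsNeighbor D s ψ i k ∧
      q ∈ edge D s ψ i j ∧ q ∈ edge D s ψ i k) ∨
    (∃ j, IsNeighbor D s ψ i j ∧ q ∈ edge D s ψ i j ∧ q ∈ arcs D s ψ i) ∨
    (∃ j, IsNeighbor D s ψ i j ∧ q ∈ edge D s ψ i j ∧ q ∈ outer D s ψ i) ∨
    (q ∈ arcs D s ψ i ∧ q ∈ outer D s ψ i)

/-- The straight line that carries the common boundary of the cells `V_i` and `V_j`. -/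
def edgeLine (i j : Fin N) : Set Plane :=
  {x | ‖x - s i‖ ^ 2 - ψ i = ‖x - s j‖ ^ 2 - ψ j}

/-- The genericity assumptions (G1)–(G7) about the seed points `s` and the weights `ψ`. -/
structure Generic : Prop where
  /-- All the cells, including the void, have positive area. -/
  G1 : ∀ a : Option (Fin N), 0 < volume (anyCell D s ψ a)
  /-- No three distinct seed points are aligned. -/
  G2 : ∀ i j k : Fin N, i ≠ j → i ≠ k → j ≠ k → ¬ Collinear ℝ {s i, s j, s k}
  /-- At a vertex between two neighboring cells and the void, `q`, `s i`, `s j` are not aligned. -/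
  G3 : ∀ q, IsVertex D s ψ q → ∀ i j : Fin N, IsNeighbor D s ψ i j →
    q ∈ cell D s ψ i → q ∈ cell D s ψ j → q ∈ voidCell D s ψ → ¬ Collinear ℝ {q, s i, s j}
  /-- Each vertex belongs to at most 3 cells. -/
  G4 : ∀ q, IsVertex D s ψ q → {a : Option (Fin N) | q ∈ anyCell D s ψ a}.ncard ≤ 3
  /-- At each vertex on `∂D`, the boundary `∂D` is smooth, and at most 2 cells meet. -/
  G5 : ∀ q, IsVertex D s ψ q → q ∈ frontier D →
    (∃ n, IsOutwardNormal D q n) ∧ {a : Option (Fin N) | q ∈ anyCell D s ψ a}.ncard ≤ 2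
  /-- At a vertex between `∂D` and two cells, the line between these cells is not orthogonal to
  the normal vector, that is, it is not tangent to `∂D`. -/
  G6 : ∀ q, IsVertex D s ψ q → ∀ n, IsOutwardNormal D q n → ∀ i j : Fin N, i ≠ j →
    q ∈ cell D s ψ i → q ∈ cell D s ψ j → ¬ ∀ x ∈ edgeLine s ψ i j, inner ℝ (x - q) n = 0
  /-- At a vertex between `∂D`, one cell and the void, the line through `q` and `s i` is not
  parallel to the normal vector, that is, the circle bounding the cell is not tangent to `∂D`. -/
  G7 : ∀ q, IsVertex D s ψ q → ∀ n, IsOutwardNormal D q n → ∀ i : Fin N,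
    q ∈ cell D s ψ i → q ∈ voidCell D s ψ → ¬ ∃ c : ℝ, q - s i = c • n

end Diagram

section Kantorovic

variable {N : ℕ} (D : Set Plane) (s : Fin N → Plane) (ν : EuclideanSpace ℝ (Fin N))

/-- The Kantorovic functional `K(s, ν, ψ)`. -/
noncomputable def kantorovic (ψ : EuclideanSpace ℝ (Fin N)) : ℝ :=
  (∑ i, ∫ x in cell D s ψ i, (‖x - s i‖ ^ 2 - ψ i)) + ∑ i, ν i * ψ i

/-- `F(s, ν, ψ) = ∇_ψ K(s, ν, ψ)`. -/
noncomputable def kantorovicGrad (ψ : EuclideanSpace ℝ (Fin N)) : EuclideanSpace ℝ (Fin N) :=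
  gradient (kantorovic D s ν) ψ

/-- The `N × N` matrix `[∇_ψ F(s, ν, ψ)]`, with entries `∂F_i / ∂ψ_j`. -/
noncomputable def kantorovicJacobian (ψ : EuclideanSpace ℝ (Fin N)) : Matrix (Fin N) (Fin N) ℝ :=
  Matrix.of fun i j => fderiv ℝ (kantorovicGrad D s ν) ψ (EuclideanSpace.single j 1) i

end Kantorovic

end ModLaguerre

namespace ModLaguerre

open Filter Set Asymptotics

/-! Almost every point of the closure of `D` has a unique cheapest cell, where the void has cost 0.
Hence `kantorovic` is the integral of the minimal cost plus a linear term, and differentiating under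
the integral gives F_i = ν_i − |V_i| at every weight vector (`hasGradientAt_kantorovic`). It remains
to differentiate the areas once.

A cell V_i is cut out of the closure of `D` by the constraints u_a ≤ ψ_i − ψ_a, one for each other
cell a, with ψ_a = 0 for the void; the level sets of u_a are parallel lines, or concentric circles
for the void. By the coarea formula, the derivative of the area in one threshold is the weighted
length w_ia ≥ 0 of the interface with a, as long as almost no point of the interface lies on ∂D or
on a second active constraint (`hasFDerivAt_measureReal_sublevel`). Genericity ensures this: triple
points are countable, and interfaces meet ∂D in a set that is countable by transversality, or null
for cells that are not neighbors.

So the negated Jacobian has off-diagonal entries −w_ij and row sums w_i0. The w_ij are symmetric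
since the Jacobian is a Hessian, and the quadratic form is ∑ w_i0 v_i² + ½ ∑ w_ij (v_i − v_j)²: a
weighted graph Laplacian grounded at the void (`posDef_of_weights`). It is definite if every
nonempty family of cells has a positive weight leading out of it. Otherwise the family and its
complement would meet inside `D` only at countably many points, which cannot separate a connected
planar open set (`Generic.exists_weight_ne_zero`). -/

/-! ### Derivatives of areas of sublevel sets through the coarea formula -/

/-- The level sets `{u = τ}`, for `τ` near `τ₀`, are parametrized by `P τ`, in such a way that the
coarea formula holds in `C` with the measure `lam` on the space of parameters. -/
structure IsSlicing (C : Set Plane) (u : Plane → ℝ) (τ₀ : ℝ) (lam : Measure ℝ)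
    (P : ℝ → ℝ → Plane) : Prop where
  finite : IsFiniteMeasure lam
  measurable : Measurable (Function.uncurry P)
  continuousAt : ∀ y, ContinuousAt (Function.uncurry P) (τ₀, y)
  level : ∀ y, u (P τ₀ y) = τ₀
  coarea : ∃ ε > 0, ∀ τ₁ τ₂, |τ₁ - τ₀| < ε → |τ₂ - τ₀| < ε → τ₁ ≤ τ₂ →
    ∀ E ⊆ C, MeasurableSet E →
      volume (E ∩ u ⁻¹' Ioc τ₁ τ₂) = ∫⁻ τ in Ioc τ₁ τ₂, lam {y | P τ y ∈ E}
  surj : ∀ x ∈ C, u x = τ₀ → ∃ y, P τ₀ y = x ∧ ∀ W ∈ 𝓝 y, 0 < lam W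
  null_of_countable : ∀ B : Set Plane, B.Countable → lam (P τ₀ ⁻¹' B) = 0

lemma measureReal_inter_le_sub {E : Set Plane} {u : Plane → ℝ} (hE : MeasurableSet E)
    (hu : Measurable u) (hfin : volume E ≠ ⊤) {a b : ℝ} (hab : a ≤ b) :
    volume.real (E ∩ {x | u x ≤ b}) - volume.real (E ∩ {x | u x ≤ a}) =
      volume.real (E ∩ u ⁻¹' Ioc a b) := by
  have h1 : E ∩ {x | u x ≤ b} = (E ∩ {x | u x ≤ a}) ∪ (E ∩ u ⁻¹' Ioc a b) := by
    ext x
    simp only [mem_inter_iff, mem_ofPred_eq, mem_union, mem_preimage, mem_Ioc]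
    constructor
    · rintro ⟨hx, hb⟩
      rcases le_or_gt (u x) a with h | h
      · exact Or.inl ⟨hx, h⟩
      · exact Or.inr ⟨hx, h, hb⟩
    · rintro (⟨hx, h⟩ | ⟨hx, h, h'⟩)
      · exact ⟨hx, h.trans hab⟩
      · exact ⟨hx, h'⟩
  have h2 : Disjoint (E ∩ {x | u x ≤ a}) (E ∩ u ⁻¹' Ioc a b) := by
    rw [Set.disjoint_left]
    rintro x ⟨_, h⟩ ⟨_, h', _⟩
    exact absurd h (not_le.2 h')
  rw [h1, measureReal_union h2 (hE.inter (hu measurableSet_Ioc))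
    (measure_ne_top_of_subset inter_subset_left hfin)
    (measure_ne_top_of_subset inter_subset_left hfin)]
  ring

/-- The area swept between the levels τ₀ and θ v is the integral of the slice measures, which tend
to `lam S` jointly in the level and in the moving set `E v`. Allowing `E` to move with `v` is what
lets several thresholds vary at once. -/
lemma IsSlicing.isLittleO {V : Type*} [NormedAddCommGroup V] {C : Set Plane} {u : Plane → ℝ}
    {τ₀ : ℝ} {lam : Measure ℝ} {P : ℝ → ℝ → Plane} (h : IsSlicing C u τ₀ lam P)
    (hC : volume C ≠ ⊤) (hu : Measurable u) {E : V → Set Plane}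
    (hE : ∀ v, MeasurableSet (E v)) (hEC : ∀ v, E v ⊆ C) {θ : V → ℝ} {v₀ : V}
    (hθ : ContinuousAt θ v₀) (hθ₀ : θ v₀ = τ₀) {S : Set ℝ} (hS : MeasurableSet S)
    (hlim : ∀ᵐ y ∂lam, ∀ᶠ p in 𝓝 ((v₀, τ₀) : V × ℝ), (P p.2 y ∈ E p.1 ↔ y ∈ S)) :
    (fun v => volume.real (E v ∩ {x | u x ≤ θ v}) - volume.real (E v ∩ {x | u x ≤ τ₀}) -
      lam.real S * (θ v - τ₀)) =o[𝓝 v₀] (fun v => θ v - τ₀) := by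
  have := h.finite
  have hfin (v) : volume (E v) ≠ ⊤ := measure_ne_top_of_subset (hEC v) hC
  have hmP (v) : MeasurableSet {p : ℝ × ℝ | P p.1 p.2 ∈ E v} := h.measurable (hE v)
  have hmP' (v τ) : MeasurableSet {y | P τ y ∈ E v} := measurable_prodMk_left (hmP v)
  -- Dominated convergence for the finite measure `lam`; the indicators are eventually constant for
  -- almost every parameter.
  have htend : Tendsto (fun p : V × ℝ => lam {y | P p.2 y ∈ E p.1}) (𝓝 (v₀, τ₀)) (𝓝 (lam S)) :=
    tendsto_measure_of_ae_tendsto_indicator_of_isFiniteMeasure _ hS (fun p => hmP' p.1 p.2) hlim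
  have htend' : Tendsto (fun p : V × ℝ => lam.real {y | P p.2 y ∈ E p.1}) (𝓝 (v₀, τ₀))
      (𝓝 (lam.real S)) := (ENNReal.tendsto_toReal (measure_ne_top _ _)).comp htend
  obtain ⟨ε, hε, hco⟩ := h.coarea
  have key (v : V) (a b : ℝ) (hab : a ≤ b) (ha : |a - τ₀| < ε) (hb : |b - τ₀| < ε) :
      volume.real (E v ∩ {x | u x ≤ b}) - volume.real (E v ∩ {x | u x ≤ a}) =
        ∫ τ in Ioc a b, lam.real {y | P τ y ∈ E v} := by
    rw [measureReal_inter_le_sub (hE v) hu (hfin v) hab, measureReal_def,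
      hco a b ha hb hab _ (hEC v) (hE v)]
    symm
    refine integral_toReal ?_ (ae_of_all _ fun τ => measure_lt_top _ _)
    exact (measurable_measure_prodMk_left (hmP v)).aemeasurable
  have hint (v : V) (a b : ℝ) : IntegrableOn (fun τ => lam.real {y | P τ y ∈ E v}) (Ioc a b) := by
    refine Measure.integrableOn_of_bounded (M := lam.real univ) (by simp) ?_ ?_
    · exact (measurable_measure_prodMk_left (hmP v)).ennreal_toReal.aestronglyMeasurable
    · refine ae_of_all _ fun τ => ?_
      rw [Real.norm_of_nonneg measureReal_nonneg]
      exact measureReal_mono (subset_univ _)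
  have key2 (v : V) (a b c : ℝ) (hab : a ≤ b) (ha : |a - τ₀| < ε) (hb : |b - τ₀| < ε)
      (hc : ∀ τ ∈ Ioc a b, |lam.real {y | P τ y ∈ E v} - lam.real S| ≤ c) :
      |volume.real (E v ∩ {x | u x ≤ b}) - volume.real (E v ∩ {x | u x ≤ a}) -
        lam.real S * (b - a)| ≤ c * (b - a) := by
    have h1 : volume.real (E v ∩ {x | u x ≤ b}) - volume.real (E v ∩ {x | u x ≤ a}) -
        lam.real S * (b - a) = ∫ τ in Ioc a b, (lam.real {y | P τ y ∈ E v} - lam.real S) := by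
      rw [key v a b hab ha hb, integral_sub (hint v a b) (by simp)]
      simp [hab, mul_comm]
    rw [h1]
    have := norm_setIntegral_le_of_norm_le_const (μ := volume) (s := Ioc a b) (C := c)
      (f := fun τ => lam.real {y | P τ y ∈ E v} - lam.real S) (by simp) (fun τ hτ => hc τ hτ)
    simpa [hab] using this
  refine isLittleO_iff.2 fun c hc => ?_
  obtain ⟨A, hA, δ, hδ, hAδ⟩ : ∃ A ∈ 𝓝 v₀, ∃ δ > 0, ∀ v ∈ A, ∀ τ, |τ - τ₀| < δ →
      |lam.real {y | P τ y ∈ E v} - lam.real S| ≤ c := by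
    have := htend'.eventually (Metric.closedBall_mem_nhds (lam.real S) hc)
    rw [nhds_prod_eq] at this
    obtain ⟨A, hA, B, hB, hAB⟩ := (eventually_prod_iff.1 this)
    obtain ⟨δ, hδ, hB'⟩ := Metric.eventually_nhds_iff.1 hB
    exact ⟨{v | A v}, hA, δ, hδ, fun v hv τ hτ => hAB hv (hB' hτ)⟩
  have hθ' : ∀ᶠ v in 𝓝 v₀, |θ v - τ₀| < min δ ε := by
    have := hθ.eventually (Metric.ball_mem_nhds (θ v₀) (lt_min hδ hε))
    rw [hθ₀] at this
    exact this
  filter_upwards [hA, hθ'] with v hv hvθ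
  have h0 : |τ₀ - τ₀| < ε := by simpa using hε
  have hvε := hvθ.trans_le (min_le_right _ _)
  have hvδ := hvθ.trans_le (min_le_left _ _)
  rw [Real.norm_eq_abs, Real.norm_eq_abs]
  rcases le_total τ₀ (θ v) with hle | hle
  · rw [abs_of_nonneg (sub_nonneg.2 hle)]
    refine key2 v τ₀ (θ v) c hle h0 hvε fun τ hτ => hAδ v hv τ ?_
    rw [abs_of_nonneg (sub_nonneg.2 hτ.1.le)]
    rw [abs_of_nonneg (sub_nonneg.2 hle)] at hvδ
    linarith [hτ.2]
  · rw [abs_of_nonpos (sub_nonpos.2 hle)]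
    have := key2 v (θ v) τ₀ c hle hvε h0 fun τ hτ => hAδ v hv τ (by
      rw [abs_of_nonpos (sub_nonpos.2 hτ.2)]
      rw [abs_of_nonpos (sub_nonpos.2 hle)] at hvδ
      linarith [hτ.1])
    rw [abs_le] at this ⊢
    constructor <;> nlinarith [this.1, this.2]

/-- Thresholds are released one at a time. Each release contributes the slice measure of its own
face, because almost every point of that face satisfies the other constraints with room to spare. -/
lemma hasFDerivAt_measureReal_sublevel {ι : Type*} [Fintype ι] [DecidableEq ι] {C : Set Plane}
    (hC : IsClosed C) (hCfin : volume C ≠ ⊤) {u : ι → Plane → ℝ} (hu : ∀ k, Continuous (u k))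
    {t₀ : ι → ℝ} {lam : ι → Measure ℝ} {P : ι → ℝ → ℝ → Plane}
    (h : ∀ k, IsSlicing C (u k) (t₀ k) (lam k) (P k))
    (hnull : ∀ k, lam k {y | (P k (t₀ k) y ∈ C ∧ ∀ j, u j (P k (t₀ k) y) ≤ t₀ j) ∧
      (P k (t₀ k) y ∉ interior C ∨ ∃ j, j ≠ k ∧ u j (P k (t₀ k) y) = t₀ j)} = 0) :
    HasFDerivAt (fun t : ι → ℝ => volume.real {x | x ∈ C ∧ ∀ j, u j x ≤ t j})
      (∑ k, (lam k).real {y | P k (t₀ k) y ∈ C ∧ ∀ j, u j (P k (t₀ k) y) ≤ t₀ j} •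
        (ContinuousLinearMap.proj k : (ι → ℝ) →L[ℝ] ℝ)) t₀ := by
  set w : ι → ℝ := fun k => (lam k).real {y | P k (t₀ k) y ∈ C ∧ ∀ j, u j (P k (t₀ k) y) ≤ t₀ j}
    with hw
  -- `J` is the set of thresholds already allowed to vary; the others are frozen at `t₀`.
  suffices H : ∀ J : Finset ι, HasFDerivAt (fun t : ι → ℝ =>
      volume.real {x | x ∈ C ∧ ∀ j, u j x ≤ if j ∈ J then t j else t₀ j})
      (∑ k ∈ J, w k • (ContinuousLinearMap.proj k : (ι → ℝ) →L[ℝ] ℝ)) t₀ by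
    simpa using H Finset.univ
  intro J
  induction J using Finset.induction_on with
  | empty => simpa using hasFDerivAt_const _ _
  | insert k J hk ih =>
    rw [Finset.sum_insert hk, add_comm]
    let E : (ι → ℝ) → Set Plane :=
      fun t => {x | x ∈ C ∧ ∀ j, j ≠ k → u j x ≤ if j ∈ J then t j else t₀ j}
    have hEclosed (t) : IsClosed (E t) := by
      have : E t = C ∩ ⋂ j, ⋂ (_ : j ≠ k), {x | u j x ≤ if j ∈ J then t j else t₀ j} := by
        ext x; simp [E]
      rw [this]
      exact hC.inter (isClosed_iInter fun j => isClosed_iInter fun _ =>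
        isClosed_le (hu j) continuous_const)
    have hcontJ (j) : Continuous fun t : ι → ℝ => if j ∈ J then t j else t₀ j := by
      split_ifs <;> fun_prop
    have hS : MeasurableSet {y | P k (t₀ k) y ∈ C ∧ ∀ j, u j (P k (t₀ k) y) ≤ t₀ j} := by
      have hP : Measurable (P k (t₀ k)) := (h k).measurable.of_uncurry_left
      have : IsClosed {x | x ∈ C ∧ ∀ j, u j x ≤ t₀ j} := by
        have : {x | x ∈ C ∧ ∀ j, u j x ≤ t₀ j} = C ∩ ⋂ j, {x | u j x ≤ t₀ j} := by ext x; simp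
        rw [this]
        exact hC.inter (isClosed_iInter fun j => isClosed_le (hu j) continuous_const)
      exact hP this.measurableSet
    have hmain := (h k).isLittleO (V := ι → ℝ) (E := E) (θ := fun t => t k) (v₀ := t₀)
      hCfin (hu k).measurable (fun t => (hEclosed t).measurableSet) (fun t x hx => hx.1)
      (continuous_apply k).continuousAt rfl hS ?_
    · have e1 (t : ι → ℝ) : {x | x ∈ C ∧ ∀ j, u j x ≤ if j ∈ insert k J then t j else t₀ j} =
          E t ∩ {x | u k x ≤ t k} := by
        ext x
        simp only [mem_ofPred_eq, E, mem_inter_iff, Finset.mem_insert, and_assoc,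
          and_congr_right_iff]
        intro _
        constructor
        · intro H
          refine ⟨fun j hj => by simpa [hj] using H j, by simpa using H k⟩
        · rintro ⟨H1, H2⟩ j
          by_cases hj : j = k
          · subst hj; simpa using H2
          · simpa [hj] using H1 j hj
      have e2 (t : ι → ℝ) : {x | x ∈ C ∧ ∀ j, u j x ≤ if j ∈ J then t j else t₀ j} =
          E t ∩ {x | u k x ≤ t₀ k} := by
        ext x
        simp only [mem_ofPred_eq, E, mem_inter_iff, and_assoc, and_congr_right_iff]
        intro _
        constructor
        · intro H
          refine ⟨fun j _ => H j, by simpa [hk] using H k⟩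
        · rintro ⟨H1, H2⟩ j
          by_cases hj : j = k
          · subst hj; simpa [hk] using H2
          · exact H1 j hj
      have hd : HasFDerivAt (fun t : ι → ℝ => volume.real (E t ∩ {x | u k x ≤ t k}) -
          volume.real (E t ∩ {x | u k x ≤ t₀ k}))
          (w k • (ContinuousLinearMap.proj k : (ι → ℝ) →L[ℝ] ℝ)) t₀ := by
        rw [hasFDerivAt_iff_isLittleO]
        have hO : (fun t : ι → ℝ => t k - t₀ k) =O[𝓝 t₀] fun t => t - t₀ :=
          IsBigO.of_bound 1 (Eventually.of_forall fun t => by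
            simpa using norm_le_pi_norm (t - t₀) k)
        refine (hmain.trans_isBigO hO).congr_left fun t => ?_
        simp only [sub_self, sub_zero, smul_apply,
          ContinuousLinearMap.proj_apply, smul_eq_mul, Pi.sub_apply]
        rfl
      have := ih.add hd
      refine this.congr_of_eventuallyEq (Eventually.of_forall fun t => ?_)
      simp only [e1, e2, Pi.add_apply]
      ring
    · have hae := measure_eq_zero_iff_ae_notMem.1 (hnull k)
      filter_upwards [hae] with y hy
      have hcP : Tendsto (fun p : (ι → ℝ) × ℝ => P k p.2 y) (𝓝 (t₀, t₀ k))
          (𝓝 (P k (t₀ k) y)) := by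
        have h1 : Tendsto (fun p : (ι → ℝ) × ℝ => (p.2, y)) (𝓝 (t₀, t₀ k)) (𝓝 (t₀ k, y)) :=
          Continuous.tendsto' (by fun_prop) _ _ rfl
        exact ((h k).continuousAt y).tendsto.comp h1
      have hcu (j) : Tendsto (fun p : (ι → ℝ) × ℝ => u j (P k p.2 y)) (𝓝 (t₀, t₀ k))
          (𝓝 (u j (P k (t₀ k) y))) := ((hu j).tendsto _).comp hcP
      have hcJ (j) : Tendsto (fun p : (ι → ℝ) × ℝ => if j ∈ J then p.1 j else t₀ j)
          (𝓝 (t₀, t₀ k)) (𝓝 (t₀ j)) := by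
        refine Continuous.tendsto' ((hcontJ j).comp continuous_fst) _ _ ?_
        simp
      by_cases hxC : P k (t₀ k) y ∈ C
      swap
      · filter_upwards [hcP.eventually (hC.isOpen_compl.mem_nhds hxC)] with p hp
        exact iff_of_false (fun H => hp H.1) (fun H => hxC H.1)
      by_cases hle : ∀ j, u j (P k (t₀ k) y) ≤ t₀ j
      swap
      · push Not at hle
        obtain ⟨j, hj⟩ := hle
        have hjk : j ≠ k := by
          rintro rfl
          rw [(h j).level] at hj
          exact lt_irrefl _ hj
        filter_upwards [(hcJ j).eventually_lt (hcu j) hj] with p hp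
        exact iff_of_false (fun H => absurd (H.2 j hjk) (not_le.2 hp))
          (fun H => absurd (H.2 j) (not_le.2 hj))
      -- Off the null set, the remaining case is a point interior to `C` with all other constraints
      -- strict, an open condition in the thresholds and the level.
      have hy' : ¬ (P k (t₀ k) y ∉ interior C ∨ ∃ j, j ≠ k ∧ u j (P k (t₀ k) y) = t₀ j) :=
        fun H => hy ⟨⟨hxC, hle⟩, H⟩
      push Not at hy'
      have h2 : ∀ᶠ p : (ι → ℝ) × ℝ in 𝓝 (t₀, t₀ k), ∀ j, j ≠ k →
          u j (P k p.2 y) < if j ∈ J then p.1 j else t₀ j := by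
        rw [eventually_all]
        intro j
        by_cases hj : j = k
        · simp [hj]
        · filter_upwards [(hcu j).eventually_lt (hcJ j) ((hle j).lt_of_ne (hy'.2 j hj))] with p hp _
          exact hp
      filter_upwards [hcP.eventually (isOpen_interior.mem_nhds hy'.1), h2] with p hp1 hp2
      exact iff_of_true ⟨interior_subset hp1, fun j hj => (hp2 j hj).le⟩ ⟨hxC, hle⟩

/-! ### Slicings by parallel lines and by concentric circles -/

/-- The point of the plane with coordinates `z` in the orthonormal basis `b`. -/
noncomputable def pointOf (b : OrthonormalBasis (Fin 2) ℝ Plane) (z : ℝ × ℝ) : Plane :=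
  b.repr.symm !₂[z.1, z.2]

lemma measurePreserving_pointOf (b : OrthonormalBasis (Fin 2) ℝ Plane) :
    MeasurePreserving (pointOf b) volume volume :=
  b.measurePreserving_repr_symm.comp
    ((EuclideanSpace.volume_preserving_symm_measurableEquiv_toLp (Fin 2)).symm.comp
      (volume_preserving_finTwoArrow ℝ).symm)

lemma continuous_pointOf (b : OrthonormalBasis (Fin 2) ℝ Plane) : Continuous (pointOf b) := by
  unfold pointOf; fun_prop

lemma pointOf_sub (b : OrthonormalBasis (Fin 2) ℝ Plane) (z z' : ℝ × ℝ) :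
    pointOf b z - pointOf b z' = pointOf b (z - z') := by
  simp only [pointOf, ← map_sub]
  congr 1
  ext i; fin_cases i <;> simp

lemma norm_sq_pointOf (b : OrthonormalBasis (Fin 2) ℝ Plane) (z : ℝ × ℝ) :
    ‖pointOf b z‖ ^ 2 = z.1 ^ 2 + z.2 ^ 2 := by
  simp [pointOf, EuclideanSpace.norm_sq_eq]

lemma inner_pointOf (b : OrthonormalBasis (Fin 2) ℝ Plane) (z : ℝ × ℝ) :
    inner ℝ (pointOf b z) (b 0) = z.1 := by
  have := b.repr_apply_apply (pointOf b z) 0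
  rw [real_inner_comm, ← this]
  simp [pointOf]

lemma pointOf_repr (b : OrthonormalBasis (Fin 2) ℝ Plane) (x : Plane) :
    pointOf b (b.repr x 0, b.repr x 1) = x := by
  rw [pointOf, LinearIsometryEquiv.symm_apply_eq]
  ext i; fin_cases i <;> simp

lemma pointOf_injective (b : OrthonormalBasis (Fin 2) ℝ Plane) :
    Function.Injective (pointOf b) := by
  intro z z' h
  have := pointOf_sub b z z'
  rw [h, sub_self] at this
  have h2 := norm_sq_pointOf b (z - z')
  rw [← this] at h2
  simp only [norm_zero, Prod.fst_sub, Prod.snd_sub] at h2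
  ext <;> nlinarith [sq_nonneg (z.1 - z'.1), sq_nonneg (z.2 - z'.2)]

lemma exists_basis_normal {p : Plane} (hp : p ≠ 0) :
    ∃ b : OrthonormalBasis (Fin 2) ℝ Plane, p = ‖p‖ • b 0 := by
  have hv : Orthonormal ℝ (({0} : Set (Fin 2)).domRestrict fun _ => ‖p‖⁻¹ • p) := by
    constructor
    · intro i
      change ‖‖p‖⁻¹ • p‖ = 1
      rw [norm_smul, norm_inv, norm_norm, inv_mul_cancel₀ (norm_ne_zero_iff.2 hp)]
    · intro i j hij
      exact absurd (Subsingleton.elim i j) hij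
  obtain ⟨b, hb⟩ := hv.exists_orthonormalBasis_extension_of_card_eq (by simp)
  refine ⟨b, ?_⟩
  rw [hb 0 rfl, smul_smul, mul_inv_cancel₀ (norm_ne_zero_iff.2 hp), one_smul]

/-- In an orthonormal frame with first axis along `c - a`, the function is affine in the first
coordinate with slope 2|c − a|, so Fubini gives the coarea formula. The lines are parametrized
isometrically, hence sets of zero length have null preimages. -/
lemma exists_isSlicing_line {C : Set Plane} (hC : Bornology.IsBounded C) {a c : Plane}
    (hac : a ≠ c) (τ₀ : ℝ) :
    ∃ lam P, IsSlicing C (fun x => ‖x - a‖ ^ 2 - ‖x - c‖ ^ 2) τ₀ lam P ∧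
      ∀ S : Set Plane, μH[1] S = 0 → lam (P τ₀ ⁻¹' S) = 0 := by
  have hp : c - a ≠ 0 := sub_ne_zero.2 hac.symm
  obtain ⟨b, hb⟩ := exists_basis_normal hp
  set k : ℝ := 2 * ‖c - a‖ with hk
  have hk0 : 0 < k := by have := norm_pos_iff.2 hp; positivity
  set d : ℝ := ‖a‖ ^ 2 - ‖c‖ ^ 2 with hd
  set u : Plane → ℝ := fun x => ‖x - a‖ ^ 2 - ‖x - c‖ ^ 2 with hu
  have hu' (z : ℝ × ℝ) : u (pointOf b z) = k * z.1 + d := by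
    have h1 : inner ℝ (pointOf b z) (c - a) = ‖c - a‖ * z.1 := by
      rw [hb, inner_smul_right, inner_pointOf, ← hb]
    rw [inner_sub_right] at h1
    simp only [hu, norm_sub_sq_real, hk, hd]
    linarith
  obtain ⟨R, hR⟩ := hC.exists_norm_le
  have hbound (z : ℝ × ℝ) (hz : pointOf b z ∈ C) : z.2 ∈ Ioo (-(|R| + 1)) (|R| + 1) := by
    have h1 := hR _ hz
    have h2 := norm_sq_pointOf b z
    have h3 : z.2 ^ 2 ≤ |R| ^ 2 := by
      nlinarith [norm_nonneg (pointOf b z), le_abs_self R, sq_nonneg z.1]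
    have := abs_le_of_sq_le_sq' h3 (abs_nonneg _)
    constructor <;> linarith [this.1, this.2]
  -- The factor is the Jacobian of z ↦ k z + d. Truncation makes the measure finite; the margin 1
  -- keeps parameters of points of `C` interior to the window, as positivity near them requires.
  set lam : Measure ℝ := ENNReal.ofReal k⁻¹ • volume.restrict (Ioo (-(|R| + 1)) (|R| + 1))
    with hlam
  set P : ℝ → ℝ → Plane := fun τ y => pointOf b ((τ - d) / k, y) with hP
  have hPcont : Continuous (Function.uncurry P) :=
    (continuous_pointOf b).comp (by fun_prop)
  have hiso (τ : ℝ) : Isometry (P τ) := by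
    refine Isometry.of_dist_eq fun y y' => ?_
    rw [dist_eq_norm, Real.dist_eq, ← sq_eq_sq₀ (norm_nonneg _) (abs_nonneg _), hP]
    simp only [pointOf_sub, norm_sq_pointOf]
    simp
  have hH (S : Set Plane) (hS : μH[1] S = 0) : lam (P τ₀ ⁻¹' S) = 0 := by
    have h1 : μH[1] (P τ₀ ⁻¹' S) = 0 := by
      have := (hiso τ₀).antilipschitz.hausdorffMeasure_preimage_le zero_le_one S
      rw [hS, mul_zero] at this
      exact le_antisymm this zero_le
    rw [hausdorffMeasure_real] at h1
    rw [hlam, Measure.smul_apply, Measure.absolutelyContinuous_restrict h1, smul_zero]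
  refine ⟨lam, P, ?_, hH⟩
  refine ⟨?_, hPcont.measurable, fun y => hPcont.continuousAt, ?_, ⟨1, one_pos, ?_⟩, ?_, ?_⟩
  · rw [hlam]
    exact Measure.smul_finite _ ENNReal.ofReal_ne_top
  · intro y
    simp only [hP]
    rw [hu']
    field_simp
    ring
  · intro τ₁ τ₂ _ _ _ E hEC hE
    have hum : Measurable u := by simp only [hu]; fun_prop
    have hmeas : MeasurableSet (pointOf b ⁻¹' (E ∩ u ⁻¹' Ioc τ₁ τ₂)) :=
      (continuous_pointOf b).measurable (hE.inter (hum measurableSet_Ioc))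
    rw [← (measurePreserving_pointOf b).measure_preimage
      (hE.inter (hum measurableSet_Ioc)).nullMeasurableSet, Measure.volume_eq_prod,
      Measure.prod_apply hmeas, ← lintegral_indicator measurableSet_Ioc]
    have hsub := lintegral_image_eq_lintegral_deriv_mul_of_monotoneOn (s := univ)
      (f := fun z => k * z + d) (f' := fun _ => k) MeasurableSet.univ
      (fun x _ => by
        have := ((hasDerivAt_id x).const_mul k).add_const d
        rw [mul_one] at this
        exact this.hasDerivWithinAt)
      (fun x _ y _ hxy => by
        have := mul_le_mul_of_nonneg_left hxy hk0.le
        dsimp only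
        linarith)
      ((Ioc τ₁ τ₂).indicator fun τ => lam {y | P τ y ∈ E})
    have himg : (fun z : ℝ => k * z + d) '' univ = univ := by
      refine eq_univ_of_forall fun τ => ⟨(τ - d) / k, mem_univ _, ?_⟩
      field_simp
      ring
    rw [himg, Measure.restrict_univ] at hsub
    rw [hsub]
    refine lintegral_congr fun z => ?_
    by_cases hz : k * z + d ∈ Ioc τ₁ τ₂
    · rw [indicator_of_mem hz, hlam, Measure.smul_apply, smul_eq_mul, ← mul_assoc,
        ← ENNReal.ofReal_mul hk0.le, mul_inv_cancel₀ hk0.ne', ENNReal.ofReal_one, one_mul,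
        Measure.restrict_eq_self]
      · congr 1
        ext y
        simp only [mem_preimage, mem_inter_iff, hu', hP, mem_ofPred_eq]
        have : (k * z + d - d) / k = z := by field_simp; ring
        rw [this]
        exact ⟨fun h => h.1, fun h => ⟨h, hz⟩⟩
      · intro y hy
        exact hbound _ (hEC hy)
    · rw [indicator_of_notMem hz, mul_zero]
      convert measure_empty (μ := (volume : Measure ℝ))
      ext y
      simp only [mem_preimage, mem_inter_iff, hu', mem_empty_iff_false, iff_false, not_and]
      exact fun _ => hz
  · intro x hxC hx
    refine ⟨b.repr x 1, ?_, ?_⟩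
    · have h1 := hu' (b.repr x 0, b.repr x 1)
      rw [pointOf_repr] at h1
      have h2 : (τ₀ - d) / k = b.repr x 0 := by
        rw [← hx, h1]; field_simp; ring
      simp only [hP, h2, pointOf_repr]
    · intro W hW
      have hx' : pointOf b (b.repr x 0, b.repr x 1) ∈ C := by rwa [pointOf_repr]
      rw [hlam, Measure.smul_apply, smul_eq_mul]
      refine ENNReal.mul_pos (by simpa using hk0) ?_
      have hW' : W ∩ Ioo (-(|R| + 1)) (|R| + 1) ∈ 𝓝 (b.repr x 1) :=
        inter_mem hW (isOpen_Ioo.mem_nhds (hbound _ hx'))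
      have h3 := Measure.measure_pos_of_mem_nhds (volume : Measure ℝ) hW'
      exact (h3.trans_le (Measure.le_restrict_apply _ _)).ne'
  · intro B hB
    refine hH B ?_
    have : NullSingletonClass (μH[1] : Measure Plane) :=
      Measure.nullSingletonClass_hausdorff _ one_pos
    exact hB.measure_zero _

/-- Polar coordinates with τ = r²: since dτ = 2r dr, the area element r dr dθ becomes ½ dτ dθ, so
the slice measure does not depend on τ. -/
lemma exists_isSlicing_circle (C : Set Plane) (a : Plane) {τ₀ : ℝ} (hτ₀ : 0 < τ₀) :
    ∃ lam P, IsSlicing C (fun x => ‖x - a‖ ^ 2) τ₀ lam P := by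
  set b : OrthonormalBasis (Fin 2) ℝ Plane := EuclideanSpace.basisFun (Fin 2) ℝ
  set u : Plane → ℝ := fun x => ‖x - a‖ ^ 2 with hu
  have hu' (z : ℝ × ℝ) : u (a + pointOf b z) = z.1 ^ 2 + z.2 ^ 2 := by
    simp [hu, norm_sq_pointOf]
  set I : Set ℝ := Ioo (-Real.pi) Real.pi with hI
  set lam : Measure ℝ := ENNReal.ofReal 2⁻¹ • volume.restrict I with hlam
  set P : ℝ → ℝ → Plane := fun τ y => a + pointOf b (polarCoord.symm (√τ, y)) with hP
  have hPcont : Continuous (Function.uncurry P) := by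
    have h1 : Continuous fun q : ℝ × ℝ => polarCoord.symm (√q.1, q.2) :=
      continuous_polarCoord_symm.comp (by fun_prop)
    exact continuous_const.add ((continuous_pointOf b).comp h1)
  have hPu (τ : ℝ) (hτ : 0 ≤ τ) (y : ℝ) : u (P τ y) = τ := by
    simp only [hP]
    rw [hu', polarCoord_symm_apply]
    simp only [mul_pow, Real.sq_sqrt hτ]
    rw [← mul_add, Real.cos_sq_add_sin_sq, mul_one]
  -- The radius `τ₀` of the interval of levels keeps every level involved positive.
  refine ⟨lam, P, ?_, hPcont.measurable, fun y => hPcont.continuousAt, hPu τ₀ hτ₀.le,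
    ⟨τ₀, hτ₀, ?_⟩, ?_, ?_⟩
  · rw [hlam]
    exact Measure.smul_finite _ ENNReal.ofReal_ne_top
  · intro τ₁ τ₂ h1 h2 h12 E _ hE
    have hτ₁ : 0 < τ₁ := by linarith [(abs_lt.1 h1).1]
    have hum : Measurable u := by simp only [hu]; fun_prop
    have hT : MeasurableSet (E ∩ u ⁻¹' Ioc τ₁ τ₂) := hE.inter (hum measurableSet_Ioc)
    have hmp : MeasurePreserving (fun z => a + pointOf b z) volume volume :=
      (measurePreserving_add_left volume a).comp (measurePreserving_pointOf b)
    have hmeas : MeasurableSet ((fun z => a + pointOf b z) ⁻¹' (E ∩ u ⁻¹' Ioc τ₁ τ₂)) :=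
      hmp.measurable hT
    set G : ℝ → ENNReal := fun τ => volume.restrict I {y | P τ y ∈ E} with hG
    rw [← hmp.measure_preimage hT.nullMeasurableSet, ← lintegral_indicator_one hmeas,
      ← lintegral_comp_polarCoord_symm, polarCoord_target, Measure.volume_eq_prod,
      setLIntegral_prod]
    swap
    · refine Measurable.aemeasurable ?_
      refine Measurable.smul (f := fun p : ℝ × ℝ => ENNReal.ofReal p.1) (by fun_prop) ?_
      exact (measurable_one.indicator hmeas).comp continuous_polarCoord_symm.measurable
    have hsub := lintegral_image_eq_lintegral_deriv_mul_of_monotoneOn (s := Ioi (0 : ℝ))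
      (f := fun r => r ^ 2) (f' := fun r => 2 * r) measurableSet_Ioi
      (fun x _ => by simpa using (hasDerivAt_pow 2 x).hasDerivWithinAt)
      (fun x hx y _ hxy => pow_le_pow_left₀ (le_of_lt hx) hxy 2)
      ((Ioc τ₁ τ₂).indicator fun τ => lam {y | P τ y ∈ E})
    have himg : (fun r : ℝ => r ^ 2) '' Ioi 0 = Ioi 0 := by
      ext τ
      constructor
      · rintro ⟨r, hr, rfl⟩
        exact pow_pos (mem_Ioi.1 hr) 2
      · intro hτ
        exact ⟨√τ, Real.sqrt_pos.2 hτ, Real.sq_sqrt (le_of_lt hτ)⟩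
    have hIoc : Ioc τ₁ τ₂ ⊆ Ioi (0 : ℝ) := fun τ hτ => hτ₁.trans hτ.1
    rw [himg, setLIntegral_indicator measurableSet_Ioc, inter_eq_self_of_subset_left hIoc] at hsub
    rw [hsub]
    refine setLIntegral_congr_fun measurableSet_Ioi fun r hr => ?_
    have hr0 : 0 < r := hr
    have hmem (y : ℝ) : polarCoord.symm (r, y) ∈
        (fun z => a + pointOf b z) ⁻¹' (E ∩ u ⁻¹' Ioc τ₁ τ₂) ↔
          P (r ^ 2) y ∈ E ∧ r ^ 2 ∈ Ioc τ₁ τ₂ := by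
      have e : a + pointOf b (polarCoord.symm (r, y)) = P (r ^ 2) y := by
        simp only [hP, Real.sqrt_sq hr0.le]
      rw [mem_preimage, e, mem_inter_iff, mem_preimage, hPu _ (sq_nonneg r)]
    by_cases hz : r ^ 2 ∈ Ioc τ₁ τ₂
    · have hset : MeasurableSet {y | P (r ^ 2) y ∈ E} :=
        (hPcont.measurable.of_uncurry_left (x := r ^ 2)) hE
      have e2 (y : ℝ) : ((fun z => a + pointOf b z) ⁻¹' (E ∩ u ⁻¹' Ioc τ₁ τ₂)).indicator
          (1 : ℝ × ℝ → ENNReal) (polarCoord.symm (r, y)) =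
          {y | P (r ^ 2) y ∈ E}.indicator 1 y := by
        by_cases hy : P (r ^ 2) y ∈ E
        · rw [indicator_of_mem ((hmem y).2 ⟨hy, hz⟩), indicator_of_mem (by exact hy)]; rfl
        · rw [indicator_of_notMem (fun h => hy ((hmem y).1 h).1), indicator_of_notMem (by exact hy)]
      simp only [e2, smul_eq_mul]
      rw [lintegral_const_mul _ (measurable_one.indicator hset), lintegral_indicator_one hset,
        indicator_of_mem hz, hlam, Measure.smul_apply, smul_eq_mul, ← mul_assoc,
        ← ENNReal.ofReal_mul (by positivity)]
      congr 2
      ring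
    · have e2 (y : ℝ) : ((fun z => a + pointOf b z) ⁻¹' (E ∩ u ⁻¹' Ioc τ₁ τ₂)).indicator
          (1 : ℝ × ℝ → ENNReal) (polarCoord.symm (r, y)) = 0 :=
        indicator_of_notMem (fun h => hz ((hmem y).1 h).2) _
      simp only [e2, indicator_of_notMem hz]
      simp
  · intro x _ hx
    set z : ℂ := ⟨b.repr (x - a) 0, b.repr (x - a) 1⟩ with hz
    have hnorm : ‖z‖ = √τ₀ := by
      rw [← Real.sqrt_sq (norm_nonneg z), ← hx, hu, Complex.sq_norm, Complex.normSq_apply]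
      have := norm_sq_pointOf b (b.repr (x - a) 0, b.repr (x - a) 1)
      rw [pointOf_repr] at this
      simp only [this, hz]
      ring_nf
    refine ⟨z.arg, ?_, ?_⟩
    · simp only [hP, polarCoord_symm_apply]
      rw [← hnorm, Complex.norm_mul_cos_arg, Complex.norm_mul_sin_arg, hz]
      simp only
      rw [pointOf_repr]
      abel
    · intro W hW
      rw [hlam, Measure.smul_apply, smul_eq_mul]
      refine ENNReal.mul_pos (by simp) ?_
      -- The argument may equal π, outside the open interval; lying in its closure suffices for
      -- neighborhoods to have positive measure.
      have hcl : z.arg ∈ closure I := by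
        rw [hI, closure_Ioo (by linarith [Real.pi_pos])]
        exact ⟨z.neg_pi_lt_arg.le, z.arg_le_pi⟩
      obtain ⟨y, hy1, hy2⟩ := mem_closure_iff.1 hcl _ isOpen_interior
        (mem_interior_iff_mem_nhds.2 hW)
      have h4 : W ∩ I ∈ 𝓝 y :=
        inter_mem (mem_interior_iff_mem_nhds.1 hy1) (isOpen_Ioo.mem_nhds hy2)
      exact ((Measure.measure_pos_of_mem_nhds (volume : Measure ℝ) h4).trans_le
        (Measure.le_restrict_apply _ _)).ne'
  · intro B hB
    have hinj : InjOn (P τ₀) I := by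
      intro y hy y' hy' h
      have h1 := pointOf_injective b (add_left_cancel h)
      have hs : 0 < √τ₀ := Real.sqrt_pos.2 hτ₀
      have h2 := polarCoord.symm.injOn (x₁ := (√τ₀, y)) (x₂ := (√τ₀, y'))
        ⟨hs, hy⟩ ⟨hs, hy'⟩ h1
      exact (Prod.ext_iff.1 h2).2
    have hcount : (P τ₀ ⁻¹' B ∩ I).Countable :=
      MapsTo.countable_of_injOn (t := B) (fun y hy => hy.1) (hinj.mono inter_subset_right) hB
    rw [hlam, Measure.smul_apply, Measure.restrict_apply' measurableSet_Ioo,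
      hcount.measure_zero, smul_zero]

/-! ### Transversality at the boundary and countable exceptional sets -/

lemma inner_plane (x y : Plane) : inner ℝ x y = x 0 * y 0 + x 1 * y 1 := by
  simp [PiLp.inner_apply, Fin.sum_univ_two, mul_comm]

lemma norm_le_abs_add_abs (w : Plane) : ‖w‖ ≤ |w 0| + |w 1| := by
  refine abs_le_of_sq_le_sq' ?_ (by positivity) |>.2
  rw [EuclideanSpace.norm_sq_eq, Fin.sum_univ_two, Real.norm_eq_abs, Real.norm_eq_abs]
  nlinarith [abs_nonneg (w 0), abs_nonneg (w 1)]

lemma exists_smul_eq_of_inner_eq_zero {w : Plane} (hw : w ≠ 0) {d : Plane}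
    (h : inner ℝ w d = 0) : ∃ r : ℝ, d = r • !₂[-w 1, w 0] := by
  rw [inner_plane] at h
  have hw2 : w 0 ^ 2 + w 1 ^ 2 ≠ 0 := by
    intro h0
    apply hw
    ext i
    fin_cases i
    · simp; nlinarith [sq_nonneg (w 0), sq_nonneg (w 1)]
    · simp; nlinarith [sq_nonneg (w 0), sq_nonneg (w 1)]
  refine ⟨(d 1 * w 0 - d 0 * w 1) / (w 0 ^ 2 + w 1 ^ 2), ?_⟩
  ext i
  fin_cases i
  · simp
    field_simp
    linear_combination w 0 * h
  · simp
    field_simp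
    linear_combination w 1 * h

lemma eventually_frontier_eq_zero {D : Set Plane} {q : Plane} {φ : Plane → ℝ} (hD : IsOpen D)
    (hφ : ContDiffAt ℝ 1 φ q) (h : ∀ᶠ x in 𝓝 q, (x ∈ D ↔ φ x < 0)) :
    ∀ᶠ z in 𝓝 q, z ∈ frontier D → φ z = 0 := by
  filter_upwards [h.eventually_nhds, hφ.eventually (by simp)] with z hz hφz hzD
  have h1 : z ∉ D := by
    rw [hD.frontier_eq] at hzD
    exact hzD.2
  have h2 : 0 ≤ φ z := by
    by_contra hlt
    exact h1 (hz.self_of_nhds.2 (not_le.1 hlt))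
  refine le_antisymm ?_ h2
  by_contra hgt
  have h3 : ∃ᶠ x in 𝓝 z, x ∈ D := mem_closure_iff_frequently.1 (frontier_subset_closure hzD)
  have h4 : ∀ᶠ x in 𝓝 z, 0 < φ x :=
    hφz.continuousAt.tendsto.eventually (lt_mem_nhds (not_le.1 hgt))
  obtain ⟨x, hx, hx4, hxz⟩ := (h3.and_eventually (h4.and hz)).exists
  exact lt_asymm hx4 (hxz.1 hx)

/-- For z in `Z` near q, the displacement z − q is nearly orthogonal to ∇φ(q), because φ vanishes on
∂D, and to `p`, by assumption. These vectors are independent, so the displacement is zero. The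
quadratic bound covers both lines and circles with normal `p` at q. -/
lemma eventually_eq_of_transversal {D : Set Plane} (hD : IsOpen D) {q n p : Plane}
    (hn : IsOutwardNormal D q n) (hp : ¬ ∃ c : ℝ, p = c • n) {Z : Set Plane}
    (hZ : Z ⊆ frontier D) (hpZ : ∀ z ∈ Z, |inner ℝ (z - q) p| ≤ ‖z - q‖ ^ 2) :
    ∀ᶠ z in 𝓝 q, z ∈ Z → z = q := by
  obtain ⟨hqD, φ, hφ, hg0, hiff, rfl⟩ := hn
  set g := gradient φ q with hg
  have hdiff : HasFDerivAt φ (InnerProductSpace.toDual ℝ Plane g) q :=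
    (hφ.differentiableAt (by simp)).hasGradientAt
  have hfr := eventually_frontier_eq_zero hD hφ hiff
  have hφq : φ q = 0 := hfr.self_of_nhds hqD
  set det : ℝ := p 0 * g 1 - p 1 * g 0 with hdet
  have hdet0 : det ≠ 0 := by
    intro h0
    apply hp
    have hgn : ‖g‖ ≠ 0 := norm_ne_zero_iff.2 hg0
    have hw : (!₂[-g 1, g 0] : Plane) ≠ 0 := by
      intro h
      apply hg0
      ext i
      fin_cases i
      · simpa using congrArg (fun v : Plane => v 1) h
      · simpa using congrArg (fun v : Plane => v 0) h
    obtain ⟨r, hr⟩ := exists_smul_eq_of_inner_eq_zero hw (d := p) (by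
      rw [inner_plane]; simp; linarith)
    refine ⟨-r * ‖g‖, ?_⟩
    rw [smul_smul, mul_assoc, mul_inv_cancel₀ hgn, hr]
    ext i
    fin_cases i <;> simp
  set M : ℝ := |g 0| + |g 1| + |p 0| + |p 1| with hM
  have hM0 : 0 ≤ M := by positivity
  -- Chosen so that δ M ≤ |det| / 2, which lets the final estimate absorb its right-hand side.
  set δ : ℝ := |det| / (2 * (M + 1)) with hδ
  have hδ0 : 0 < δ := by have := abs_pos.2 hdet0; positivity
  have hlo := (isLittleO_iff.1 hdiff.isLittleO) hδ0
  filter_upwards [hfr, hlo, Metric.ball_mem_nhds q hδ0] with z hz1 hz2 hz3 hzZ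
  rw [hz1 (hZ hzZ), hφq, InnerProductSpace.toDual_apply_apply] at hz2
  have hB : |inner ℝ (z - q) g| ≤ δ * ‖z - q‖ := by
    rw [real_inner_comm]
    simpa using hz2
  have hA : |inner ℝ (z - q) p| ≤ δ * ‖z - q‖ := by
    refine (hpZ z hzZ).trans ?_
    rw [sq]
    refine mul_le_mul_of_nonneg_right ?_ (norm_nonneg _)
    rw [← dist_eq_norm]
    exact (Metric.mem_ball.1 hz3).le
  set w : Plane := z - q with hw
  -- Cramer's rule recovers the displacement from its inner products with `p` and `g`.
  have e0 : w 0 * det = inner ℝ w p * g 1 - inner ℝ w g * p 1 := by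
    rw [inner_plane, inner_plane]; ring
  have e1 : w 1 * det = inner ℝ w g * p 0 - inner ℝ w p * g 0 := by
    rw [inner_plane, inner_plane]; ring
  have b0 : |w 0| * |det| ≤ δ * ‖w‖ * (|g 1| + |p 1|) := by
    rw [← abs_mul, e0]
    refine (abs_sub _ _).trans ?_
    rw [abs_mul, abs_mul]
    nlinarith [abs_nonneg (g 1), abs_nonneg (p 1)]
  have b1 : |w 1| * |det| ≤ δ * ‖w‖ * (|p 0| + |g 0|) := by
    rw [← abs_mul, e1]
    refine (abs_sub _ _).trans ?_
    rw [abs_mul, abs_mul]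
    nlinarith [abs_nonneg (g 0), abs_nonneg (p 0)]
  have b2 : ‖w‖ * |det| ≤ δ * ‖w‖ * M := by
    have := mul_le_mul_of_nonneg_right (norm_le_abs_add_abs w) (abs_nonneg det)
    rw [hM]
    nlinarith
  have b3 : δ * M ≤ |det| / 2 := by
    have : δ * (M + 1) = |det| / 2 := by rw [hδ]; field_simp
    nlinarith
  have b4 : ‖w‖ * (|det| / 2) ≤ 0 := by nlinarith [norm_nonneg w]
  have b5 : ‖w‖ ≤ 0 := by
    by_contra hcon
    have := mul_pos (not_le.1 hcon) (half_pos (abs_pos.2 hdet0))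
    linarith
  exact sub_eq_zero.1 (norm_le_zero_iff.1 b5)

/-- Such a set is discrete in its subspace topology, and a discrete Lindelöf space is countable. -/
lemma countable_of_eventually_eq {Z : Set Plane} (h : ∀ q ∈ Z, ∀ᶠ z in 𝓝 q, z ∈ Z → z = q) :
    Z.Countable := by
  have : DiscreteTopology Z := by
    rw [discreteTopology_iff_singleton_mem_nhds]
    intro q
    rw [nhds_subtype, mem_comap]
    refine ⟨_, h q q.2, fun z hz => ?_⟩
    exact Subtype.ext (hz z.2)
  exact countable_coe_iff.1 countable_of_Lindelof_of_discrete

/-- Two distinct common points x, y would make both b − a and c − a orthogonal to x − y, forcing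
collinearity. So there is at most one. -/
lemma countable_radical_center {a b c : Plane} (h : ¬ Collinear ℝ {a, b, c}) (α β γ : ℝ) :
    {x : Plane | ‖x - a‖ ^ 2 - α = ‖x - b‖ ^ 2 - β ∧
      ‖x - a‖ ^ 2 - α = ‖x - c‖ ^ 2 - γ}.Countable := by
  refine Subsingleton.countable fun x hx y hy => ?_
  by_contra hxy
  apply h
  have hw : x - y ≠ 0 := sub_ne_zero.2 hxy
  have key (d : Plane) (δ : ℝ) (h1 : ‖x - a‖ ^ 2 - α = ‖x - d‖ ^ 2 - δ)
      (h2 : ‖y - a‖ ^ 2 - α = ‖y - d‖ ^ 2 - δ) : inner ℝ (x - y) (d - a) = 0 := by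
    simp only [norm_sub_sq_real] at h1 h2
    simp only [inner_sub_left, inner_sub_right]
    linarith
  obtain ⟨r, hr⟩ := exists_smul_eq_of_inner_eq_zero hw (key b β hx.1 hy.1)
  obtain ⟨r', hr'⟩ := exists_smul_eq_of_inner_eq_zero hw (key c γ hx.2 hy.2)
  rw [collinear_iff_of_mem (p₀ := a) (by simp)]
  refine ⟨!₂[-(x - y) 1, (x - y) 0], ?_⟩
  simp only [mem_insert_iff, mem_singleton_iff, forall_eq_or_imp, forall_eq, vadd_eq_add]
  exact ⟨⟨0, by simp⟩, ⟨r, by rw [← hr]; abel⟩, ⟨r', by rw [← hr']; abel⟩⟩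

lemma countable_circle_inter {a b : Plane} (h : a ≠ b) (α β : ℝ) :
    {x : Plane | ‖x - a‖ ^ 2 = α ∧ ‖x - b‖ ^ 2 = β}.Countable := by
  by_cases hs : {x : Plane | ‖x - a‖ ^ 2 = α ∧ ‖x - b‖ ^ 2 = β}.Subsingleton
  · exact hs.countable
  rw [Set.not_subsingleton_iff] at hs
  obtain ⟨x, hx, y, hy, hxy⟩ := hs
  have key (c z : Plane) (γ : ℝ) (hz : ‖z - c‖ ^ 2 = γ) : dist z c = √γ := by
    rw [← hz, Real.sqrt_sq (norm_nonneg _), dist_eq_norm]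
  refine (((countable_singleton y).insert x)).mono fun z hz => ?_
  have := EuclideanGeometry.eq_of_dist_eq_of_dist_eq_of_finrank_eq_two (by simp) h hxy
    (key _ _ _ hx.1) (key _ _ _ hy.1) (key _ _ _ hz.1) (key _ _ _ hx.2) (key _ _ _ hy.2)
    (key _ _ _ hz.2)
  simpa using this

/-! ### Countable sets do not separate planar domains, and Lipschitz boundaries are null -/

lemma dense_compl_of_countable {T : Set Plane} (hT : T.Countable) : Dense Tᶜ :=
  hT.dense_compl ℝ

lemma isPreconnected_ball_diff_countable {T : Set Plane} (hT : T.Countable) (x : Plane) {r : ℝ}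
    (hr : 0 < r) : IsPreconnected (Metric.ball x r \ T) := by
  set e := OpenPartialHomeomorph.univBall x r with he
  have hinj : Function.Injective e := by
    intro y z h
    exact e.injOn (by simp [he]) (by simp [he]) h
  have h1 : (e ⁻¹' T).Countable := hT.preimage hinj
  have h2 : IsConnected (e ⁻¹' T)ᶜ := h1.isConnected_compl_of_one_lt_rank (by
    rw [← Module.finrank_eq_rank]
    simp)
  have h3 : e '' (e ⁻¹' T)ᶜ = Metric.ball x r \ T := by
    rw [← preimage_compl, image_preimage_eq_inter_range, inter_comm, sdiff_eq]
    congr 1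
    rw [← image_univ, ← OpenPartialHomeomorph.univBall_target x hr, ← e.image_source_eq_target]
    simp [he]
  rw [← h3]
  exact h2.isPreconnected.image _ (OpenPartialHomeomorph.continuous_univBall x r).continuousOn

/-- A small disc minus the countable overlap is still connected, so it lies in one of the two closed
sets, and by density so does the disc. Thus the interiors of `A` and `B` cover `D`; they cannot
overlap there, since a nonempty open set is uncountable, and connectedness concludes. -/
lemma subset_or_subset_of_countable_inter {D A B : Set Plane} (hD : IsOpen D)
    (hDc : IsPreconnected D) (hA : IsClosed A) (hB : IsClosed B) (hAB : D ⊆ A ∪ B)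
    (hT : (D ∩ A ∩ B).Countable) : D ⊆ A ∨ D ⊆ B := by
  have hloc : ∀ x ∈ D, x ∈ interior A ∨ x ∈ interior B := by
    intro x hx
    obtain ⟨r, hr, hball⟩ := Metric.isOpen_iff.1 hD x hx
    set T := D ∩ A ∩ B with hTdef
    have hdense : Metric.ball x r ⊆ closure (Metric.ball x r \ T) := by
      rw [sdiff_eq]
      exact (dense_compl_of_countable hT).open_subset_closure_inter Metric.isOpen_ball
    have hpre := isPreconnected_ball_diff_countable hT x hr
    rw [isPreconnected_closed_iff] at hpre
    have hsub : Metric.ball x r \ T ⊆ A ∪ B := fun y hy => hAB (hball hy.1)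
    have hemp : ¬ ((Metric.ball x r \ T) ∩ (A ∩ B)).Nonempty := by
      rintro ⟨y, ⟨hy1, hy2⟩, hyA, hyB⟩
      exact hy2 ⟨⟨hball hy1, hyA⟩, hyB⟩
    have conc (F : Set Plane) (hF : IsClosed F) (h : Metric.ball x r \ T ⊆ F) : x ∈ interior F :=
      interior_maximal (hdense.trans (closure_minimal h hF)) Metric.isOpen_ball
        (Metric.mem_ball_self hr)
    by_cases hA' : ((Metric.ball x r \ T) ∩ A).Nonempty
    · by_cases hB' : ((Metric.ball x r \ T) ∩ B).Nonempty
      · exact absurd (hpre A B hA hB hsub hA' hB') hemp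
      · refine Or.inl (conc A hA fun y hy => (hsub hy).resolve_right fun h => hB' ⟨y, hy, h⟩)
    · refine Or.inr (conc B hB fun y hy => (hsub hy).resolve_left fun h => hA' ⟨y, hy, h⟩)
  by_contra hcon
  push Not at hcon
  obtain ⟨x, hxD, hxA⟩ := not_subset.1 hcon.1
  obtain ⟨y, hyD, hyB⟩ := not_subset.1 hcon.2
  have hx := (hloc x hxD).resolve_left fun h => hxA (interior_subset h)
  have hy := (hloc y hyD).resolve_right fun h => hyB (interior_subset h)
  obtain ⟨z, hzD, hzA, hzB⟩ := hDc (interior A) (interior B) isOpen_interior isOpen_interior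
    (fun w hw => hloc w hw) ⟨y, hyD, hy⟩ ⟨x, hxD, hx⟩
  have hopen : IsOpen (D ∩ (interior A ∩ interior B)) :=
    hD.inter (isOpen_interior.inter isOpen_interior)
  have hcount : (D ∩ (interior A ∩ interior B)).Countable :=
    hT.mono fun w (hw : w ∈ D ∩ (interior A ∩ interior B)) =>
      (⟨⟨hw.1, interior_subset hw.2.1⟩, interior_subset hw.2.2⟩ : w ∈ D ∩ A ∩ B)
  have hpos := hopen.measure_pos (volume : Measure Plane) ⟨z, hzD, hzA, hzB⟩
  rw [hcount.measure_zero] at hpos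
  exact lt_irrefl _ hpos

lemma volume_graph_eq_zero (b : OrthonormalBasis (Fin 2) ℝ Plane) (p : Plane) {γ : ℝ → ℝ}
    (hγ : Continuous γ) : volume {x : Plane | b.repr (x - p) 1 = γ (b.repr (x - p) 0)} = 0 := by
  have hmp : MeasurePreserving (fun z => p + pointOf b z) volume volume :=
    (measurePreserving_add_left volume p).comp (measurePreserving_pointOf b)
  have hcl : IsClosed {x : Plane | b.repr (x - p) 1 = γ (b.repr (x - p) 0)} :=
    isClosed_eq (by fun_prop) (by fun_prop)
  rw [← hmp.measure_preimage hcl.measurableSet.nullMeasurableSet, Measure.volume_eq_prod,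
    Measure.measure_prod_null (hmp.measurable hcl.measurableSet)]
  refine ae_of_all _ fun z => ?_
  refine measure_mono_null (t := {γ z}) (fun y hy => ?_) (by simp)
  simpa [pointOf] using hy

/-- Locally the boundary lies in the graph of a continuous function, null by Fubini. -/
lemma IsLipschitzDomain.volume_frontier {D : Set Plane} (hD : IsLipschitzDomain D) :
    volume (frontier D) = 0 := by
  refine measure_null_of_locally_null _ fun p hp => ?_
  obtain ⟨b, L, γ, hγ, hloc⟩ := hD.locally_subgraph p hp
  have hγc := hγ.continuous
  refine ⟨_, inter_mem_nhdsWithin _ hloc.eventually_nhds, ?_⟩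
  refine measure_mono_null (fun x hx => ?_) (volume_graph_eq_zero b p hγc)
  obtain ⟨hxD, hx⟩ := hx
  have c0 : Continuous fun x : Plane => b.repr (x - p) 0 := by fun_prop
  have c1 : Continuous fun x : Plane => b.repr (x - p) 1 := by fun_prop
  have hxnD : x ∉ D := by
    rw [hD.isOpen.frontier_eq] at hxD
    exact hxD.2
  have hx' : ∀ᶠ y in 𝓝 x, (y ∈ D ↔ b.repr (y - p) 1 < γ (b.repr (y - p) 0)) := hx
  rcases lt_trichotomy (b.repr (x - p) 1) (γ (b.repr (x - p) 0)) with h | h | h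
  · exact absurd (hx'.self_of_nhds.2 h) hxnD
  · exact h
  · have hfreq : ∃ᶠ y in 𝓝 x, y ∈ D :=
      mem_closure_iff_frequently.1 (frontier_subset_closure hxD)
    have hgt : ∀ᶠ y in 𝓝 x, γ (b.repr (y - p) 0) < b.repr (y - p) 1 :=
      ((hγc.comp c0).tendsto x).eventually_lt (c1.tendsto x) h
    obtain ⟨y, hy1, hy2, hy3⟩ := (hfreq.and_eventually (hgt.and hx')).exists
    exact absurd (hy3.1 hy1) (not_lt.2 hy2.le)

/-! ### Cells as sets of minimizers of a cost, the void being one of the competitors -/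

section Cost

variable {N : ℕ}

/-- The squared distance to the seed point of a cell, and `0` for the void. -/
noncomputable def sqDist (s : Fin N → Plane) : Option (Fin N) → Plane → ℝ
  | none, _ => 0
  | some i, x => ‖x - s i‖ ^ 2

/-- The weight of a cell as a linear function of the vector of weights; it is `0` for the void. -/
noncomputable def weight : Option (Fin N) → EuclideanSpace ℝ (Fin N) →L[ℝ] ℝ
  | none => 0
  | some i => EuclideanSpace.proj i

/-- The cost of assigning the point `x` to a cell. -/
noncomputable def cost (s : Fin N → Plane) (φ : EuclideanSpace ℝ (Fin N)) (a : Option (Fin N))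
    (x : Plane) : ℝ :=
  sqDist s a x - weight a φ

@[simp] lemma weight_none (φ : EuclideanSpace ℝ (Fin N)) : weight none φ = 0 := rfl

@[simp] lemma weight_some (i : Fin N) (φ : EuclideanSpace ℝ (Fin N)) :
    weight (some i) φ = φ i := rfl

@[simp] lemma cost_none (s : Fin N → Plane) (φ : EuclideanSpace ℝ (Fin N)) (x : Plane) :
    cost s φ none x = 0 := by simp [cost, sqDist]

@[simp] lemma cost_some (s : Fin N → Plane) (φ : EuclideanSpace ℝ (Fin N)) (i : Fin N) (x : Plane) :
    cost s φ (some i) x = ‖x - s i‖ ^ 2 - φ i := rfl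

lemma continuous_sqDist (s : Fin N → Plane) (a : Option (Fin N)) : Continuous (sqDist s a) := by
  cases a with
  | none => exact continuous_const
  | some i =>
    change Continuous fun x => ‖x - s i‖ ^ 2
    fun_prop

lemma continuous_cost (s : Fin N → Plane) (φ : EuclideanSpace ℝ (Fin N)) (a : Option (Fin N)) :
    Continuous (cost s φ a) := (continuous_sqDist s a).sub continuous_const

lemma mem_anyCell {D : Set Plane} {s : Fin N → Plane} {φ : EuclideanSpace ℝ (Fin N)}
    {a : Option (Fin N)} {x : Plane} :
    x ∈ anyCell D s φ a ↔ x ∈ closure D ∧ ∀ b, cost s φ a x ≤ cost s φ b x := by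
  cases a with
  | none => simp [anyCell, voidCell, Option.forall]
  | some i =>
    simp only [anyCell, cell, lagCell, mem_inter_iff, mem_ofPred_eq, Option.forall, cost_none,
      cost_some, sub_nonpos, and_assoc]
    refine and_congr_right fun _ => ?_
    constructor
    · rintro ⟨h1, h2⟩
      refine ⟨h2, fun j => ?_⟩
      by_cases hj : j = i
      · rw [hj]
      · exact h1 j hj
    · rintro ⟨h1, h2⟩
      exact ⟨fun j _ => h2 j, h1⟩

lemma isClosed_anyCell (D : Set Plane) (s : Fin N → Plane) (φ : EuclideanSpace ℝ (Fin N))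
    (a : Option (Fin N)) : IsClosed (anyCell D s φ a) := by
  have : anyCell D s φ a = closure D ∩ ⋂ b, {x | cost s φ a x ≤ cost s φ b x} := by
    ext x; simp [mem_anyCell]
  rw [this]
  exact isClosed_closure.inter
    (isClosed_iInter fun b => isClosed_le (continuous_cost s φ a) (continuous_cost s φ b))

lemma anyCell_subset (D : Set Plane) (s : Fin N → Plane) (φ : EuclideanSpace ℝ (Fin N))
    (a : Option (Fin N)) : anyCell D s φ a ⊆ closure D := fun _ h => (mem_anyCell.1 h).1

lemma exists_mem_anyCell {D : Set Plane} (s : Fin N → Plane) (φ : EuclideanSpace ℝ (Fin N))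
    {x : Plane} (hx : x ∈ closure D) : ∃ a, x ∈ anyCell D s φ a := by
  obtain ⟨a, ha⟩ := Finite.exists_min fun a => cost s φ a x
  exact ⟨a, mem_anyCell.2 ⟨hx, ha⟩⟩

lemma abs_weight_le (a : Option (Fin N)) (φ : EuclideanSpace ℝ (Fin N)) : |weight a φ| ≤ ‖φ‖ := by
  cases a with
  | none => simp
  | some i => exact PiLp.norm_apply_le φ i

end Cost

section Measure

variable {N : ℕ} {s : Fin N → Plane}

lemma volume_line_eq_zero {a c : Plane} (hac : a ≠ c) (τ : ℝ) :
    volume {x : Plane | ‖x - a‖ ^ 2 - ‖x - c‖ ^ 2 = τ} = 0 := by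
  have hp : c - a ≠ 0 := sub_ne_zero.2 hac.symm
  have hp' : ‖c - a‖ ≠ 0 := norm_ne_zero_iff.2 hp
  obtain ⟨b, hb⟩ := exists_basis_normal hp
  have hcl : IsClosed {x : Plane | ‖x - a‖ ^ 2 - ‖x - c‖ ^ 2 = τ} :=
    isClosed_eq (by fun_prop) (by fun_prop)
  rw [← (measurePreserving_pointOf b).measure_preimage hcl.measurableSet.nullMeasurableSet]
  refine measure_mono_null
    (t := {(τ - ‖a‖ ^ 2 + ‖c‖ ^ 2) / (2 * ‖c - a‖)} ×ˢ (univ : Set ℝ)) (fun z hz => ?_) ?_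
  · have h1 : inner ℝ (pointOf b z) (c - a) = ‖c - a‖ * z.1 := by
      rw [hb, inner_smul_right, inner_pointOf, ← hb]
    rw [inner_sub_right] at h1
    simp only [mem_preimage, mem_ofPred_eq, norm_sub_sq_real] at hz
    refine ⟨?_, mem_univ _⟩
    rw [mem_singleton_iff, eq_div_iff (by positivity)]
    linarith
  · rw [Measure.volume_eq_prod, Measure.prod_prod]
    simp

lemma volume_cost_eq_zero (hs : Function.Injective s) (φ : EuclideanSpace ℝ (Fin N))
    {a b : Option (Fin N)} (hab : a ≠ b) : volume {x | cost s φ a x = cost s φ b x} = 0 := by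
  have hcirc (i : Fin N) : volume {x : Plane | ‖x - s i‖ ^ 2 = φ i} = 0 := by
    refine measure_mono_null (t := Metric.sphere (s i) (√(φ i))) (fun x hx => ?_)
      (Measure.addHaar_sphere _ _ _)
    rw [mem_sphere_iff_norm, ← hx, Real.sqrt_sq (norm_nonneg _)]
  match a, b with
  | none, none => exact absurd rfl hab
  | none, some i =>
    refine measure_mono_null (fun x hx => ?_) (hcirc i)
    simp only [mem_ofPred_eq, cost_none, cost_some] at hx ⊢
    linarith
  | some i, none =>
    refine measure_mono_null (fun x hx => ?_) (hcirc i)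
    simp only [mem_ofPred_eq, cost_none, cost_some] at hx ⊢
    linarith
  | some i, some j =>
    have hij : s i ≠ s j := fun h => hab (congrArg some (hs h))
    refine measure_mono_null (fun x hx => ?_) (volume_line_eq_zero hij (φ i - φ j))
    simp only [mem_ofPred_eq, cost_some] at hx ⊢
    linarith

lemma ae_cost_injective (hs : Function.Injective s) (φ : EuclideanSpace ℝ (Fin N)) (C : Set Plane) :
    ∀ᵐ x ∂(volume.restrict C), ∀ a b, cost s φ a x = cost s φ b x → a = b := by
  refine ae_restrict_of_ae ?_
  rw [ae_all_iff]
  intro a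
  rw [ae_all_iff]
  intro b
  by_cases hab : a = b
  · exact ae_of_all _ fun _ _ => hab
  · filter_upwards [measure_eq_zero_iff_ae_notMem.1 (volume_cost_eq_zero hs φ hab)] with x hx h
    exact absurd h hx

end Measure

/-! ### The functional as an integral of the minimal cost, and its gradient -/

section Gradient

variable {N : ℕ}

/-- The minimal cost at the point `x`. -/
noncomputable def minCost (s : Fin N → Plane) (φ : EuclideanSpace ℝ (Fin N)) (x : Plane) : ℝ :=
  Finset.univ.inf' Finset.univ_nonempty fun a => cost s φ a x

variable {s : Fin N → Plane}

lemma minCost_le (φ : EuclideanSpace ℝ (Fin N)) (x : Plane) (a : Option (Fin N)) :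
    minCost s φ x ≤ cost s φ a x := Finset.inf'_le _ (Finset.mem_univ a)

lemma minCost_eq {φ : EuclideanSpace ℝ (Fin N)} {x : Plane} {a : Option (Fin N)}
    (h : ∀ b, cost s φ a x ≤ cost s φ b x) : minCost s φ x = cost s φ a x :=
  le_antisymm (minCost_le φ x a) (Finset.le_inf' _ _ fun b _ => h b)

lemma continuous_minCost (φ : EuclideanSpace ℝ (Fin N)) : Continuous (minCost s φ) :=
  Continuous.finset_inf'_apply _ fun a _ => continuous_cost s φ a

lemma minCost_sub_le (φ φ' : EuclideanSpace ℝ (Fin N)) (x : Plane) :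
    minCost s φ x - minCost s φ' x ≤ ‖φ - φ'‖ := by
  obtain ⟨a, ha⟩ := Finite.exists_min fun a => cost s φ' a x
  rw [minCost_eq ha]
  have h1 := minCost_le (s := s) φ x a
  have h2 := abs_le.1 (abs_weight_le a (φ - φ'))
  rw [map_sub] at h2
  simp only [cost] at h1 ⊢
  linarith [h2.1]

lemma lipschitzWith_minCost (x : Plane) : LipschitzWith 1 fun φ => minCost s φ x := by
  refine LipschitzWith.of_dist_le_mul fun φ φ' => ?_
  rw [Real.dist_eq, dist_eq_norm, NNReal.coe_one, one_mul, abs_le]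
  have h1 := minCost_sub_le (s := s) φ φ' x
  have h2 := minCost_sub_le (s := s) φ' φ x
  rw [norm_sub_rev] at h2
  constructor <;> linarith

lemma hasFDerivAt_minCost {φ : EuclideanSpace ℝ (Fin N)} {x : Plane} {a : Option (Fin N)}
    (h : ∀ b, b ≠ a → cost s φ a x < cost s φ b x) :
    HasFDerivAt (fun φ => minCost s φ x) (-weight a) φ := by
  have hc (b : Option (Fin N)) : Continuous fun φ => cost s φ b x := by
    simp only [cost]; fun_prop
  have hd : HasFDerivAt (fun φ => cost s φ a x) (-weight a) φ := by
    simpa only [cost] using (weight a).hasFDerivAt.const_sub (sqDist s a x)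
  refine hd.congr_of_eventuallyEq ?_
  have : ∀ᶠ φ' in 𝓝 φ, ∀ b, b ≠ a → cost s φ' a x < cost s φ' b x := by
    rw [eventually_all]
    intro b
    by_cases hb : b = a
    · simp [hb]
    · filter_upwards [((hc a).tendsto φ).eventually_lt ((hc b).tendsto φ) (h b hb)] with φ' h' _
      exact h'
  filter_upwards [this] with φ' h'
  refine minCost_eq fun b => ?_
  by_cases hb : b = a
  · rw [hb]
  · exact (h' b hb).le

variable {D : Set Plane}

lemma cell_eq_anyCell (D : Set Plane) (s : Fin N → Plane) (φ : EuclideanSpace ℝ (Fin N))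
    (i : Fin N) : cell D s φ i = anyCell D s φ (some i) := rfl

lemma kantorovic_eq_integral_minCost (hD : Bornology.IsBounded D) (hs : Function.Injective s)
    (ν φ : EuclideanSpace ℝ (Fin N)) :
    kantorovic D s ν φ = (∫ x in closure D, minCost s φ x) + ∑ i, ν i * φ i := by
  have hcomp : IsCompact (closure D) := hD.isCompact_closure
  rw [kantorovic]
  congr 1
  have h1 (i : Fin N) : ∫ x in cell D s φ i, (‖x - s i‖ ^ 2 - φ i) =
      ∫ x in closure D, (cell D s φ i).indicator (cost s φ (some i)) x := by
    rw [cell_eq_anyCell, setIntegral_indicator (isClosed_anyCell D s φ (some i)).measurableSet,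
      inter_eq_self_of_subset_right (anyCell_subset D s φ (some i))]
    rfl
  rw [Finset.sum_congr rfl fun i _ => h1 i, ← integral_finsetSum]
  swap
  · intro i _
    exact ((continuous_cost s φ (some i)).continuousOn.integrableOn_compact hcomp).indicator
      (isClosed_anyCell D s φ (some i)).measurableSet
  refine integral_congr_ae ?_
  filter_upwards [ae_cost_injective hs φ (closure D),
    ae_restrict_mem isClosed_closure.measurableSet] with x hinj hx
  obtain ⟨a, ha⟩ := exists_mem_anyCell s φ hx
  have hmin := (mem_anyCell.1 ha).2
  have huniq (b) (hb : x ∈ anyCell D s φ b) : b = a :=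
    hinj _ _ (le_antisymm ((mem_anyCell.1 hb).2 a) (hmin b))
  rw [minCost_eq hmin]
  cases a with
  | none =>
    rw [cost_none]
    refine Finset.sum_eq_zero fun i _ => indicator_of_notMem (fun h => ?_) _
    exact absurd (huniq (some i) h) (by simp)
  | some i =>
    rw [Finset.sum_eq_single i (fun j _ hj => indicator_of_notMem (fun h => hj ?_) _) (by simp),
      indicator_of_mem (by exact ha)]
    exact Option.some_injective _ (huniq (some j) h)

/-- The minimal cost is 1-Lipschitz in the weights, which dominates the difference quotients. At
almost every point the minimizer is unique and stays so for nearby weights, so the derivative there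
is that of a single cost. -/
lemma hasGradientAt_kantorovic (hD : Bornology.IsBounded D) (hs : Function.Injective s)
    (ν φ : EuclideanSpace ℝ (Fin N)) :
    HasGradientAt (kantorovic D s ν)
      (WithLp.toLp 2 fun i => ν i - volume.real (cell D s φ i)) φ := by
  have hcomp : IsCompact (closure D) := hD.isCompact_closure
  have hfin : IsFiniteMeasure (volume.restrict (closure D)) :=
    ⟨by rw [Measure.restrict_apply_univ]; exact hcomp.measure_lt_top⟩
  set F' : Plane → EuclideanSpace ℝ (Fin N) →L[ℝ] ℝ :=
    fun x => ∑ i, (cell D s φ i).indicator (fun _ => -weight (some i)) x with hF'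
  have hF'meas : Measurable F' := by
    refine Finset.measurable_sum _ fun i _ => ?_
    exact measurable_const.indicator (isClosed_anyCell D s φ (some i)).measurableSet
  have hmain := (hasFDerivAt_integral_of_dominated_loc_of_lip (μ := volume.restrict (closure D))
    (F := fun φ x => minCost s φ x) (F' := F') (x₀ := φ) (s := univ) (bound := fun _ => 1)
    univ_mem (Eventually.of_forall fun φ' => (continuous_minCost φ').aestronglyMeasurable)
    ((continuous_minCost φ).continuousOn.integrableOn_compact hcomp)
    hF'meas.aestronglyMeasurable
    (ae_of_all _ fun x => by
      simpa using lipschitzWith_minCost x)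
    (integrable_const _) ?_).2
  · have hint : ∫ x in closure D, F' x = ∑ i, -(volume.real (cell D s φ i)) • weight (some i) := by
      rw [hF', integral_finsetSum]
      · refine Finset.sum_congr rfl fun i _ => ?_
        rw [cell_eq_anyCell,
          setIntegral_indicator (isClosed_anyCell D s φ (some i)).measurableSet,
          inter_eq_self_of_subset_right (anyCell_subset D s φ (some i)), setIntegral_const,
          smul_neg]
        exact (neg_smul _ _).symm
      · intro i _
        exact (integrable_const _).indicator (isClosed_anyCell D s φ (some i)).measurableSet
    have hlin : HasFDerivAt (fun φ : EuclideanSpace ℝ (Fin N) => ∑ i, ν i * φ i)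
        (∑ i, ν i • weight (some i)) φ := by
      have h0 := (∑ i, ν i • weight (N := N) (some i)).hasFDerivAt (x := φ)
      refine h0.congr_of_eventuallyEq (Eventually.of_forall fun φ' => ?_)
      simp
    rw [hint] at hmain
    rw [hasGradientAt_iff_hasFDerivAt]
    refine ((hmain.add hlin).congr_of_eventuallyEq
      (Eventually.of_forall fun φ' => kantorovic_eq_integral_minCost hD hs ν φ')).congr_fderiv ?_
    ext v
    simp only [add_apply, sum_apply,
      smul_apply, weight_some, smul_eq_mul,
      InnerProductSpace.toDual_apply_apply, PiLp.inner_apply, RCLike.inner_apply, conj_trivial]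
    rw [← Finset.sum_add_distrib]
    refine Finset.sum_congr rfl fun i _ => ?_
    ring
  · filter_upwards [ae_cost_injective hs φ (closure D),
      ae_restrict_mem isClosed_closure.measurableSet] with x hinj hx
    obtain ⟨a, ha⟩ := exists_mem_anyCell s φ hx
    have hmin := (mem_anyCell.1 ha).2
    have huniq (b) (hb : x ∈ anyCell D s φ b) : b = a :=
      hinj _ _ (le_antisymm ((mem_anyCell.1 hb).2 a) (hmin b))
    have hstrict (b) (hb : b ≠ a) : cost s φ a x < cost s φ b x :=
      (hmin b).lt_of_ne fun h => hb (hinj _ _ h).symm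
    have hF'x : F' x = -weight a := by
      cases a with
      | none =>
        have : weight (none : Option (Fin N)) = 0 := rfl
        rw [this, neg_zero]
        refine Finset.sum_eq_zero fun i _ => indicator_of_notMem (fun h => ?_) _
        exact absurd (huniq (some i) h) (by simp)
      | some i =>
        rw [hF']
        dsimp only
        rw [Finset.sum_eq_single i (fun j _ hj => indicator_of_notMem (fun h => hj ?_) _) (by simp),
          indicator_of_mem (by exact ha)]
        exact Option.some_injective _ (huniq (some j) h)
    rw [hF'x]
    exact hasFDerivAt_minCost hstrict

end Gradient

/-! ### Consequences of genericity, interface weights and positive definiteness -/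

section Generic

variable {N : ℕ} {D : Set Plane} {s : Fin N → Plane} {ψ : EuclideanSpace ℝ (Fin N)}

/-- A set of nonzero two-dimensional Hausdorff measure has infinite length, and Lebesgue measure is
absolutely continuous with respect to that measure. -/
lemma hausdorffMeasure_pos_of_volume_pos {S : Set Plane} (h : 0 < volume S) : 0 < μH[1] S := by
  rcases Measure.hausdorffMeasure_zero_or_top (one_lt_two : (1 : ℝ) < 2) S with h2 | h1
  · have hH : (μH[2] : Measure Plane).IsAddHaarMeasure := by
      have := isAddHaarMeasure_hausdorffMeasure (E := Plane)
      rwa [finrank_euclideanSpace, Fintype.card_fin, Nat.cast_ofNat] at this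
    have hac := Measure.absolutelyContinuous_isAddHaarMeasure (volume : Measure Plane) μH[2]
    exact absurd (hac h2) h.ne'
  · rw [h1]
    exact ENNReal.zero_lt_top

lemma Generic.nonempty (hG : Generic D s ψ) (a : Option (Fin N)) : (anyCell D s ψ a).Nonempty :=
  nonempty_of_measure_ne_zero (hG.G1 a).ne'

lemma Generic.weight_pos (hG : Generic D s ψ) (i : Fin N) : 0 < ψ i := by
  by_contra hle
  have h1 : cell D s ψ i ⊆ {s i} := by
    intro x hx
    have h2 : ‖x - s i‖ ^ 2 ≤ ψ i := hx.2
    have h3 : ‖x - s i‖ = 0 := by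
      have := norm_nonneg (x - s i)
      nlinarith
    exact sub_eq_zero.1 (norm_eq_zero.1 h3)
  have h2 := (hG.G1 (some i)).trans_le (measure_mono h1)
  simp at h2

/-- With a third index, coinciding seeds contradict (G2). With only two, the nonempty cells force
equal weights, so the cells coincide; a point of zero cost then lies in both cells and the void,
against (G3). -/
lemma Generic.seed_injective (hG : Generic D s ψ) (hD : IsPreconnected D) :
    Function.Injective s := by
  intro i j hij
  by_contra hne
  by_cases hk : ∃ k, k ≠ i ∧ k ≠ j
  · obtain ⟨k, hki, hkj⟩ := hk
    refine hG.G2 i j k hne hki.symm hkj.symm ?_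
    rw [hij, insert_eq_of_mem (by simp)]
    exact collinear_pair ℝ _ _
  · push Not at hk
    have hle (i j : Fin N) (hij : s i = s j) : ψ j ≤ ψ i := by
      obtain ⟨x, hx⟩ := hG.nonempty (some i)
      have := (mem_anyCell.1 hx).2 (some j)
      rw [cost_some, cost_some, hij] at this
      linarith
    have hψ : ψ i = ψ j := le_antisymm (hle j i hij.symm) (hle i j hij)
    have hcost (x : Plane) (k : Fin N) : cost s ψ (some k) x = cost s ψ (some i) x := by
      by_cases hki : k = i
      · rw [hki]
      · rw [hk k hki, cost_some, cost_some, hij, hψ]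
    obtain ⟨x, hx⟩ := hG.nonempty (some i)
    obtain ⟨y, hy⟩ := hG.nonempty none
    obtain ⟨hxD, hx⟩ := mem_anyCell.1 hx
    obtain ⟨hyD, hy⟩ := mem_anyCell.1 hy
    have hx0 := hx none
    have hy0 := hy (some i)
    rw [cost_none] at hx0 hy0
    -- The cost is nonpositive on the cell and nonnegative on the void, so it vanishes somewhere on
    -- the connected closure.
    obtain ⟨q, hqD, hq⟩ := hD.closure.intermediate_value hxD hyD
      (continuous_cost s ψ (some i)).continuousOn ⟨hx0, hy0⟩
    have hcost' (a b : Option (Fin N)) : cost s ψ a q ≤ cost s ψ b q := by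
      have h0 (a : Option (Fin N)) : cost s ψ a q = 0 := by
        cases a with
        | none => simp
        | some k => rw [hcost, hq]
      rw [h0, h0]
    have hmem (a : Option (Fin N)) : q ∈ anyCell D s ψ a := mem_anyCell.2 ⟨hqD, hcost' a⟩
    have hnb : IsNeighbor D s ψ i j := by
      refine ⟨hne, hausdorffMeasure_pos_of_volume_pos ?_⟩
      have : cell D s ψ i ∩ cell D s ψ j = cell D s ψ i := by
        refine inter_eq_left.2 fun z hz => ?_
        rw [cell_eq_anyCell, mem_anyCell] at hz ⊢
        rw [hcost z j]
        exact hz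
      rw [this]
      exact hG.G1 (some i)
    refine hG.G3 q ⟨i, Or.inr (Or.inl ⟨j, hnb, ⟨hmem (some i), hmem (some j)⟩,
      ⟨hmem (some i), hmem none⟩⟩)⟩ i j hnb (hmem (some i)) (hmem (some j)) (hmem none) ?_
    rw [hij, insert_eq_of_mem (a := s j) (by simp)]
    exact collinear_pair ℝ _ _

/-- Without the void this is a radical center, controlled by (G2); with the void it is the
intersection of two circles with distinct centers. -/
lemma Generic.countable_triple (hG : Generic D s ψ) (hs : Function.Injective s)
    {a b c : Option (Fin N)} (hab : a ≠ b) (hac : a ≠ c) (hbc : b ≠ c) :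
    {x | cost s ψ a x = cost s ψ b x ∧ cost s ψ a x = cost s ψ c x}.Countable := by
  have hcirc {i j : Fin N} (hij : some i ≠ some j) :
      {x : Plane | cost s ψ (some i) x = 0 ∧ cost s ψ (some j) x = 0}.Countable := by
    refine (countable_circle_inter (fun h => hij (congrArg some (hs h))) (ψ i) (ψ j)).mono
      fun x hx => ?_
    simp only [mem_ofPred_eq, cost_some] at hx ⊢
    constructor <;> linarith [hx.1, hx.2]
  match a, b, c with
  | some i, some j, some k =>
    exact countable_radical_center (hG.G2 i j k (fun h => hab (congrArg some h))
      (fun h => hac (congrArg some h)) (fun h => hbc (congrArg some h))) _ _ _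
  | none, none, _ => exact absurd rfl hab
  | none, _, none => exact absurd rfl hac
  | _, none, none => exact absurd rfl hbc
  | none, some j, some k =>
    refine (hcirc hbc).mono fun x hx => ?_
    simp only [mem_ofPred_eq, cost_none] at hx ⊢
    exact ⟨hx.1.symm, hx.2.symm⟩
  | some i, none, some k =>
    refine (hcirc hac).mono fun x hx => ?_
    simp only [mem_ofPred_eq, cost_none] at hx ⊢
    exact ⟨hx.1, hx.2.symm.trans hx.1⟩
  | some i, some j, none =>
    refine (hcirc hab).mono fun x hx => ?_
    simp only [mem_ofPred_eq, cost_none] at hx ⊢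
    exact ⟨hx.2, hx.1.symm.trans hx.2⟩

lemma Generic.countable_edge_inter_frontier (hG : Generic D s ψ) (hD : IsOpen D) {i j : Fin N}
    (hij : IsNeighbor D s ψ i j) (hs : s i ≠ s j) :
    (cell D s ψ i ∩ cell D s ψ j ∩ frontier D).Countable := by
  have hline {x : Plane} (h1 : x ∈ cell D s ψ i) (h2 : x ∈ cell D s ψ j) :
      ‖x - s i‖ ^ 2 - ψ i = ‖x - s j‖ ^ 2 - ψ j :=
    le_antisymm ((mem_anyCell (a := some i).1 h1).2 (some j))
      ((mem_anyCell (a := some j).1 h2).2 (some i))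
  have horth {x y : Plane} (h1 : ‖x - s i‖ ^ 2 - ψ i = ‖x - s j‖ ^ 2 - ψ j)
      (h2 : ‖y - s i‖ ^ 2 - ψ i = ‖y - s j‖ ^ 2 - ψ j) : inner ℝ (x - y) (s j - s i) = 0 := by
    simp only [norm_sub_sq_real] at h1 h2
    simp only [inner_sub_left, inner_sub_right]
    linarith
  refine countable_of_eventually_eq fun q ⟨⟨hqi, hqj⟩, hqD⟩ => ?_
  have hv : IsVertex D s ψ q :=
    ⟨i, Or.inr (Or.inr (Or.inl ⟨j, hij, ⟨hqi, hqj⟩, ⟨hqi, hqD⟩⟩))⟩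
  obtain ⟨⟨n, hn⟩, -⟩ := hG.G5 q hv hqD
  -- The vector s_j − s_i is normal to the edge line; were it parallel to n, the line would be
  -- orthogonal to n, which (G6) excludes.
  refine eventually_eq_of_transversal hD hn (p := s j - s i) ?_ (fun z hz => hz.2) ?_
  · rintro ⟨c, hc⟩
    refine hG.G6 q hv n hn i j hij.1 hqi hqj fun x hx => ?_
    have h1 := horth hx (hline hqi hqj)
    rw [hc, inner_smul_right] at h1
    refine (mul_eq_zero.1 h1).resolve_left fun hc0 => ?_
    rw [hc0, zero_smul] at hc
    exact hs (sub_eq_zero.1 hc).symm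
  · rintro z ⟨⟨hzi, hzj⟩, -⟩
    rw [horth (hline hzi hzj) (hline hqi hqj), abs_zero]
    positivity

lemma Generic.countable_arcs_inter_frontier (hG : Generic D s ψ) (hD : IsOpen D) (i : Fin N) :
    (cell D s ψ i ∩ voidCell D s ψ ∩ frontier D).Countable := by
  have hcirc {x : Plane} (h1 : x ∈ cell D s ψ i) (h2 : x ∈ voidCell D s ψ) :
      ‖x - s i‖ ^ 2 = ψ i := le_antisymm h1.2 (sub_nonneg.1 (h2.2 i))
  refine countable_of_eventually_eq fun q ⟨⟨hqi, hq0⟩, hqD⟩ => ?_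
  have hv : IsVertex D s ψ q := ⟨i, Or.inr (Or.inr (Or.inr ⟨⟨hqi, hq0⟩, ⟨hqi, hqD⟩⟩))⟩
  obtain ⟨⟨n, hn⟩, -⟩ := hG.G5 q hv hqD
  refine eventually_eq_of_transversal hD hn (hG.G7 q hv n hn i hqi hq0) (fun z hz => hz.2) ?_
  rintro z ⟨⟨hzi, hz0⟩, -⟩
  have h1 := hcirc hzi hz0
  -- On the circle, the inner product of z − q with the radius q − s_i equals −|z − q|² / 2.
  have h2 := norm_add_sq_real (z - q) (q - s i)
  rw [sub_add_sub_cancel, h1, hcirc hqi hq0] at h2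
  rw [abs_le]
  constructor <;> nlinarith [sq_nonneg ‖z - q‖]

lemma exists_slicing_cell (hG : Generic D s ψ) (hD : IsOpen D) (hDb : Bornology.IsBounded D)
    (hs : Function.Injective s) (i : Fin N) (a : Option (Fin N)) (ha : a ≠ some i) :
    ∃ lam P, IsSlicing (closure D) (fun x => sqDist s (some i) x - sqDist s a x)
        (weight (some i) ψ - weight a ψ) lam P ∧
      lam (P (weight (some i) ψ - weight a ψ) ⁻¹'
        (cell D s ψ i ∩ anyCell D s ψ a ∩ frontier D)) = 0 := by
  cases a with
  | none =>
    obtain ⟨lam, P, h⟩ := exists_isSlicing_circle (closure D) (s i) (hG.weight_pos i)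
    refine ⟨lam, P, by simpa [sqDist] using h, ?_⟩
    rw [weight_none, sub_zero]
    exact h.null_of_countable _ (hG.countable_arcs_inter_frontier hD i)
  | some j =>
    have hij : i ≠ j := fun h => ha (congrArg some h.symm)
    obtain ⟨lam, P, h, hH⟩ := exists_isSlicing_line hDb.closure (hs.ne hij) (ψ i - ψ j)
    refine ⟨lam, P, h, ?_⟩
    -- Transversality is available only at vertices, hence only for neighbors; otherwise the whole
    -- interface has zero length.
    by_cases hnb : IsNeighbor D s ψ i j
    · exact h.null_of_countable _ (hG.countable_edge_inter_frontier hD hnb (hs.ne hij))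
    · have h0 : μH[1] (cell D s ψ i ∩ cell D s ψ j) = 0 := by
        by_contra hne
        exact hnb ⟨hij, pos_iff_ne_zero.2 hne⟩
      exact hH _ (measure_mono_null inter_subset_left h0)

/-- The area of a cell is differentiable with respect to the weights. The coefficient `w a` measures
the interface with the cell `a`. -/
lemma exists_hasFDerivAt_volume_cell (hG : Generic D s ψ) (hD : IsOpen D)
    (hDb : Bornology.IsBounded D) (hs : Function.Injective s) (i : Fin N) :
    ∃ w : Option (Fin N) → ℝ, (∀ a, 0 ≤ w a) ∧
      HasFDerivAt (fun φ => volume.real (cell D s φ i))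
        (∑ a, w a • (weight (some i) - weight a)) ψ ∧
      ∀ a, a ≠ some i → ∀ x ∈ D, x ∈ cell D s ψ i → x ∈ anyCell D s ψ a →
        (∀ b, x ∈ anyCell D s ψ b → b = some i ∨ b = a) → 0 < w a := by
  classical
  let ι := {a : Option (Fin N) // a ≠ some i}
  choose lam P hP hfr using fun a : ι => exists_slicing_cell hG hD hDb hs i a a.2
  set u : ι → Plane → ℝ := fun a x => sqDist s (some i) x - sqDist s a x with hu
  set L : EuclideanSpace ℝ (Fin N) →L[ℝ] (ι → ℝ) :=
    ContinuousLinearMap.pi fun a => weight (some i) - weight (a : Option (Fin N)) with hL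
  have hLapp (φ) (a : ι) : L φ a = weight (some i) φ - weight (a : Option (Fin N)) φ := rfl
  have hucont (a : ι) : Continuous (u a) := (continuous_sqDist s _).sub (continuous_sqDist s _)
  have hmem (φ : EuclideanSpace ℝ (Fin N)) (x : Plane) :
      x ∈ cell D s φ i ↔ x ∈ closure D ∧ ∀ a, u a x ≤ L φ a := by
    rw [cell_eq_anyCell, mem_anyCell]
    refine and_congr_right fun _ => ?_
    have hiff (a : ι) : u a x ≤ L φ a ↔ cost s φ (some i) x ≤ cost s φ a x := by
      simp only [hu, hLapp, cost]
      constructor <;> intro h <;> linarith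
    simp only [hiff]
    constructor
    · exact fun h a => h a
    · intro h b
      by_cases hb : b = some i
      · rw [hb]
      · exact h ⟨b, hb⟩
  have heq (φ : EuclideanSpace ℝ (Fin N)) (a : ι) (x : Plane) :
      u a x = L φ a ↔ cost s φ (some i) x = cost s φ a x := by
    simp only [hu, hLapp, cost]
    constructor <;> intro h <;> linarith
  have hmema {x : Plane} {a : ι} (hx : x ∈ cell D s ψ i) (hxa : u a x = L ψ a) :
      x ∈ anyCell D s ψ a := by
    rw [heq] at hxa
    rw [cell_eq_anyCell, mem_anyCell] at hx
    exact mem_anyCell.2 ⟨hx.1, fun b => hxa ▸ hx.2 b⟩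
  have hder := hasFDerivAt_measureReal_sublevel (C := closure D) isClosed_closure
    hDb.isCompact_closure.measure_ne_top hucont (t₀ := L ψ) (lam := lam) (P := P) hP ?_
  · set w' : ι → ℝ := fun k =>
      (lam k).real {y | P k (L ψ k) y ∈ closure D ∧ ∀ j, u j (P k (L ψ k) y) ≤ L ψ j} with hw'
    -- The value at `some i` is immaterial for the derivative, as its functional vanishes; 0 keeps
    -- it nonnegative.
    refine ⟨fun a => if h : a ≠ some i then w' ⟨a, h⟩ else 0, ?_, ?_, ?_⟩
    · intro a
      dsimp only
      split_ifs
      · exact measureReal_nonneg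
      · exact le_rfl
    · have hc := HasFDerivAt.comp ψ hder L.hasFDerivAt
      refine (hc.congr_of_eventuallyEq (Eventually.of_forall fun φ => ?_)).congr_fderiv ?_
      · exact congrArg volume.real (Set.ext fun x => hmem φ x)
      · rw [ContinuousLinearMap.finsetSum_comp]
        have h1 : ∑ a ∈ Finset.univ.filter (fun a : Option (Fin N) => a ≠ some i),
            (if h : a ≠ some i then w' ⟨a, h⟩ else 0) • (weight (some i) - weight a) =
            ∑ a : ι, w' a • (weight (some i) - weight (a : Option (Fin N))) := by
          rw [Finset.sum_subtype (p := fun a => a ≠ some i) _ (by simp)]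
          refine Finset.sum_congr rfl fun a _ => ?_
          rw [dif_pos a.2]
        rw [← Finset.sum_filter_add_sum_filter_not Finset.univ (fun a => a ≠ some i), h1,
          Finset.sum_eq_zero (s := Finset.univ.filter fun a => ¬ a ≠ some i), add_zero]
        · rfl
        · intro a ha
          dsimp only
          rw [dif_neg (Finset.mem_filter.1 ha).2, zero_smul]
    · intro a ha x hxD hxi hxa hx
      dsimp only
      rw [dif_pos ha]
      set k : ι := ⟨a, ha⟩
      have hxk : u k x = L ψ k := by
        rw [heq]
        exact le_antisymm ((mem_anyCell (a := some i).1 hxi).2 a) ((mem_anyCell.1 hxa).2 (some i))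
      obtain ⟨y, hy, hpos⟩ := (hP k).surj x (subset_closure hxD) hxk
      change P k (L ψ k) y = x at hy
      have := (hP k).finite
      refine ENNReal.toReal_pos (hpos _ ?_).ne' (measure_ne_top _ _)
      have hcP : ContinuousAt (fun y => P k (L ψ k) y) y :=
        ((hP k).continuousAt y).comp (f := fun y => (L ψ k, y)) (by fun_prop)
      -- Near a point of `D` in exactly two cells, the other constraints stay strict along the level
      -- curve, so a whole neighborhood of parameters contributes to the weight.
      have h2 : ∀ᶠ y' in 𝓝 y, ∀ j, j ≠ k → u j (P k (L ψ k) y') < L ψ j := by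
        rw [eventually_all]
        intro j
        by_cases hj : j = k
        · simp [hj]
        · have hlt : u j (P k (L ψ k) y) < L ψ j := by
            rw [hy]
            refine (((hmem ψ x).1 hxi).2 j).lt_of_ne fun h => ?_
            rcases hx j (hmema hxi h) with h' | h'
            · exact j.2 h'
            · exact hj (Subtype.ext h')
          filter_upwards [(((hucont j).continuousAt.comp hcP).tendsto).eventually
            (gt_mem_nhds hlt)] with y' h' _
          exact h'
      have hD' : ∀ᶠ y' in 𝓝 y, P k (L ψ k) y' ∈ D :=
        hcP.tendsto.eventually (hD.mem_nhds (by rw [hy]; exact hxD))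
      filter_upwards [h2, hD'] with y' h2 h3
      refine ⟨subset_closure h3, fun j => ?_⟩
      by_cases hj : j = k
      · rw [hj]
        exact ((hP k).level y').le
      · exact (h2 j hj).le
  · intro k
    -- A bad point of the face either lies on ∂D or has a second active constraint, which makes it a
    -- triple point.
    have hcount : (⋃ b : ι, ⋃ _ : b ≠ k, {x | cost s ψ (some i) x = cost s ψ k x ∧
        cost s ψ (some i) x = cost s ψ b x}).Countable := by
      refine countable_iUnion fun b => countable_iUnion fun hb => ?_
      exact hG.countable_triple hs k.2.symm b.2.symm fun h => hb (Subtype.ext h.symm)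
    refine measure_mono_null (fun y hy => ?_)
      (measure_union_null (hfr k) ((hP k).null_of_countable _ hcount))
    obtain ⟨hycell, hy⟩ := hy
    have hcell := (hmem ψ _).2 hycell
    have hlev := (hP k).level y
    rcases hy with hy | ⟨b, hbk, hb⟩
    · refine Or.inl ⟨⟨hcell, hmema hcell hlev⟩, hycell.1, fun h => hy ?_⟩
      exact interior_mono subset_closure h
    · refine Or.inr ?_
      simp only [mem_preimage, mem_iUnion]
      exact ⟨b, hbk, (heq ψ k _).1 hlev, (heq ψ b _).1 hb⟩

lemma Generic.not_countable_inter (hG : Generic D s ψ) (hD : IsLipschitzDomain D)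
    (a : Option (Fin N)) {T : Set Plane} (hT : T.Countable) (h : D ∩ anyCell D s ψ a ⊆ T) :
    False := by
  have h1 : anyCell D s ψ a ⊆ T ∪ frontier D := by
    intro x hx
    by_cases hxD : x ∈ D
    · exact Or.inl (h ⟨hxD, hx⟩)
    · refine Or.inr ?_
      rw [hD.isOpen.frontier_eq]
      exact ⟨anyCell_subset D s ψ a hx, hxD⟩
  have h2 := (hG.G1 a).trans_le (measure_mono h1)
  rw [measure_union_null (hT.measure_zero _) hD.volume_frontier] at h2
  exact lt_irrefl _ h2

/-- A family of cells that does not contain the void is not isolated: it has an interface of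
positive length with a cell outside of the family. -/
lemma Generic.exists_weight_ne_zero (hG : Generic D s ψ) (hD : IsLipschitzDomain D)
    (hs : Function.Injective s) {w : Fin N → Option (Fin N) → ℝ}
    (hw : ∀ i a, a ≠ some i → ∀ x ∈ D, x ∈ cell D s ψ i → x ∈ anyCell D s ψ a →
      (∀ b, x ∈ anyCell D s ψ b → b = some i ∨ b = a) → 0 < w i a)
    {S : Set (Fin N)} (hS : S.Nonempty) : ∃ i ∈ S, ∃ a, (∀ j ∈ S, a ≠ some j) ∧ w i a ≠ 0 := by
  by_contra! hcon
  set A : Set Plane := ⋃ i ∈ S, cell D s ψ i with hA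
  set B : Set Plane := ⋃ a ∈ {a : Option (Fin N) | ∀ j ∈ S, a ≠ some j}, anyCell D s ψ a with hB
  have hAcl : IsClosed A := (Set.toFinite S).isClosed_biUnion fun i _ =>
    isClosed_anyCell D s ψ (some i)
  have hBcl : IsClosed B := (Set.toFinite _).isClosed_biUnion fun a _ => isClosed_anyCell D s ψ a
  have hAB : D ⊆ A ∪ B := by
    intro x hx
    obtain ⟨a, ha⟩ := exists_mem_anyCell s ψ (subset_closure hx)
    by_cases h : ∀ j ∈ S, a ≠ some j
    · exact Or.inr (mem_biUnion (x := a) h ha)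
    · push Not at h
      obtain ⟨j, hj, rfl⟩ := h
      exact Or.inl (mem_biUnion (x := j) hj ha)
  -- A point of `D` in exactly one cell of the family and one outside would give a positive weight,
  -- so only triple points remain.
  have hT : (D ∩ A ∩ B).Countable := by
    have hcount : (⋃ a : Option (Fin N), ⋃ b : Option (Fin N), ⋃ c : Option (Fin N),
        ⋃ _ : a ≠ b ∧ a ≠ c ∧ b ≠ c,
        {x | cost s ψ a x = cost s ψ b x ∧ cost s ψ a x = cost s ψ c x}).Countable :=
      countable_iUnion fun a => countable_iUnion fun b => countable_iUnion fun c =>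
        countable_iUnion fun h => hG.countable_triple hs h.1 h.2.1 h.2.2
    refine hcount.mono ?_
    rintro x ⟨⟨hxD, hxA⟩, hxB⟩
    simp only [hA, hB, mem_iUnion] at hxA hxB
    obtain ⟨i, hi, hxi⟩ := hxA
    obtain ⟨a, ha, hxa⟩ := hxB
    have hai : a ≠ some i := ha i hi
    have h3 : ¬ ∀ b, x ∈ anyCell D s ψ b → b = some i ∨ b = a := fun h =>
      (hw i a hai x hxD hxi hxa h).ne' (hcon i hi a ha)
    push Not at h3
    obtain ⟨b, hxb, hbi, hba⟩ := h3
    have hcost {a b : Option (Fin N)} (h : x ∈ anyCell D s ψ a) (h' : x ∈ anyCell D s ψ b) :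
        cost s ψ a x = cost s ψ b x :=
      le_antisymm ((mem_anyCell.1 h).2 b) ((mem_anyCell.1 h').2 a)
    simp only [mem_iUnion]
    exact ⟨some i, a, b, ⟨hai.symm, hbi.symm, hba.symm⟩, hcost hxi hxa, hcost hxi hxb⟩
  -- If `D` lies in `A`, the void is countable inside `D`; if it lies in `B`, a cell of the family
  -- is. Both contradict positive area.
  rcases subset_or_subset_of_countable_inter hD.isOpen hD.isConnected.isPreconnected hAcl hBcl
    hAB hT with h | h
  · refine hG.not_countable_inter hD none hT fun x hx => ⟨⟨hx.1, h hx.1⟩, ?_⟩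
    exact mem_biUnion (x := none) (fun j _ => by simp) hx.2
  · obtain ⟨i, hi⟩ := hS
    refine hG.not_countable_inter hD (some i) hT fun x hx => ⟨⟨hx.1, ?_⟩, h hx.1⟩
    exact mem_biUnion (x := i) hi hx.2

/-- The matrix is a graph Laplacian with the void as grounded vertex. Its form is a sum of
nonnegative terms, and an edge leaving the support of v contributes w v_i² > 0. -/
lemma posDef_of_weights {w : Fin N → Option (Fin N) → ℝ} (hnonneg : ∀ i a, 0 ≤ w i a)
    (hsymm : ∀ i j, w i (some j) = w j (some i))
    (hconn : ∀ S : Set (Fin N), S.Nonempty →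
      ∃ i ∈ S, ∃ a, (∀ j ∈ S, a ≠ some j) ∧ w i a ≠ 0)
    {M : Matrix (Fin N) (Fin N) ℝ}
    (hM : ∀ i j, M i j = (if i = j then ∑ a, w i a else 0) - w i (some j)) : M.PosDef := by
  refine Matrix.PosDef.of_dotProduct_mulVec_pos ?_ fun v hv => ?_
  · ext i j
    simp only [Matrix.conjTranspose_apply, star_trivial, hM]
    rw [hsymm j i]
    by_cases h : i = j
    · subst h; rfl
    · rw [if_neg h, if_neg (Ne.symm h)]
  have hquad : star v ⬝ᵥ M.mulVec v =
      ∑ i, w i none * v i ^ 2 + (∑ i, ∑ j, w i (some j) * (v i - v j) ^ 2) / 2 := by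
    have h1 : star v ⬝ᵥ M.mulVec v =
        ∑ i, (w i none * v i ^ 2 + ∑ j, (w i (some j) * v i ^ 2 - w i (some j) * (v i * v j))) := by
      simp only [dotProduct, Matrix.mulVec, Pi.star_apply, star_trivial]
      refine Finset.sum_congr rfl fun i _ => ?_
      simp only [hM, sub_mul, ite_mul, zero_mul, Finset.sum_sub_distrib, Finset.sum_ite_eq,
        Finset.mem_univ, if_true, Fintype.sum_option]
      rw [mul_sub, Finset.mul_sum, ← Finset.sum_mul]
      have : ∑ j, v i * (w i (some j) * v j) = ∑ j, w i (some j) * (v i * v j) :=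
        Finset.sum_congr rfl fun j _ => by ring
      rw [this]
      ring
    have h2 : ∑ i, ∑ j, w i (some j) * v j ^ 2 = ∑ i, ∑ j, w i (some j) * v i ^ 2 := by
      rw [Finset.sum_comm]
      exact Finset.sum_congr rfl fun i _ => Finset.sum_congr rfl fun j _ => by rw [hsymm]
    have h3 : ∑ i, ∑ j, w i (some j) * (v i - v j) ^ 2 =
        ∑ i, ∑ j, w i (some j) * v i ^ 2 - 2 * ∑ i, ∑ j, w i (some j) * (v i * v j) +
          ∑ i, ∑ j, w i (some j) * v j ^ 2 := by
      simp only [Finset.mul_sum, ← Finset.sum_sub_distrib, ← Finset.sum_add_distrib]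
      exact Finset.sum_congr rfl fun i _ => Finset.sum_congr rfl fun j _ => by ring
    rw [h1, h3, h2]
    simp only [Finset.sum_add_distrib, Finset.sum_sub_distrib]
    ring
  rw [hquad]
  have hn1 (i) : 0 ≤ w i none * v i ^ 2 := mul_nonneg (hnonneg i _) (sq_nonneg _)
  have hn2 (i j) : 0 ≤ w i (some j) * (v i - v j) ^ 2 := mul_nonneg (hnonneg i _) (sq_nonneg _)
  have hs1 : 0 ≤ ∑ i, w i none * v i ^ 2 := Finset.sum_nonneg fun i _ => hn1 i
  have hs2 : 0 ≤ ∑ i, ∑ j, w i (some j) * (v i - v j) ^ 2 :=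
    Finset.sum_nonneg fun i _ => Finset.sum_nonneg fun j _ => hn2 i j
  obtain ⟨i, hi, a, ha, hwa⟩ := hconn {i | v i ≠ 0} (by
    obtain ⟨i, hi⟩ := Function.ne_iff.1 hv
    exact ⟨i, hi⟩)
  have hwpos : 0 < w i a := lt_of_le_of_ne (hnonneg i a) hwa.symm
  have hvi : 0 < v i ^ 2 := by have : v i ≠ 0 := hi; positivity
  cases a with
  | none =>
    have : 0 < ∑ i, w i none * v i ^ 2 :=
      Finset.sum_pos' (fun i _ => hn1 i) ⟨i, Finset.mem_univ _, mul_pos hwpos hvi⟩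
    linarith
  | some j =>
    have hvj : v j = 0 := by
      by_contra h
      exact ha j h rfl
    have : 0 < ∑ i, ∑ j, w i (some j) * (v i - v j) ^ 2 := by
      refine Finset.sum_pos' (fun i _ => Finset.sum_nonneg fun j _ => hn2 i j)
        ⟨i, Finset.mem_univ _, Finset.sum_pos' (fun j _ => hn2 i j) ⟨j, Finset.mem_univ _, ?_⟩⟩
      rw [hvj, sub_zero]
      exact mul_pos hwpos hvi
    linarith

end Generic

end ModLaguerre


/-! ### Assembly: the Jacobian as a negated grounded Laplacian -/

theorem corollaryB1 {N : ℕ} (D : Set ModLaguerre.Plane) (hD : ModLaguerre.IsLipschitzDomain D)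
    (s : Fin N → ModLaguerre.Plane) (ν ψ : EuclideanSpace ℝ (Fin N))
    (hG : ModLaguerre.Generic D s ψ) :
    (∀ᶠ φ in 𝓝 ψ, DifferentiableAt ℝ (ModLaguerre.kantorovic D s ν) φ) ∧
    DifferentiableAt ℝ (ModLaguerre.kantorovicGrad D s ν) ψ ∧
    (-ModLaguerre.kantorovicJacobian D s ν ψ).PosDef ∧
    IsUnit (ModLaguerre.kantorovicJacobian D s ν ψ) := by
  have hs := hG.seed_injective hD.isConnected.isPreconnected
  have hgrad := ModLaguerre.hasGradientAt_kantorovic hD.isBounded hs ν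
  have hF (φ : EuclideanSpace ℝ (Fin N)) (i : Fin N) : ModLaguerre.kantorovicGrad D s ν φ i =
      ν i - volume.real (ModLaguerre.cell D s φ i) := by
    rw [ModLaguerre.kantorovicGrad, (hgrad φ).gradient]
  choose w hwnonneg hwder hwpos using
    ModLaguerre.exists_hasFDerivAt_volume_cell hG hD.isOpen hD.isBounded hs
  have hFi (i : Fin N) : HasFDerivAt (fun φ => ModLaguerre.kantorovicGrad D s ν φ i)
      (-∑ a, w i a • (ModLaguerre.weight (some i) - ModLaguerre.weight a)) ψ := by
    simp only [hF]
    exact (hwder i).const_sub (ν i)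
  have hdiff : DifferentiableAt ℝ (ModLaguerre.kantorovicGrad D s ν) ψ :=
    differentiableAt_euclidean.2 fun i => (hFi i).differentiableAt
  have hJ (i : Fin N) (v : EuclideanSpace ℝ (Fin N)) :
      fderiv ℝ (ModLaguerre.kantorovicGrad D s ν) ψ v i =
        -∑ a, w i a * (v i - ModLaguerre.weight a v) := by
    have h1 := ((EuclideanSpace.proj i : EuclideanSpace ℝ (Fin N) →L[ℝ] ℝ).hasFDerivAt.comp ψ
      hdiff.hasFDerivAt).unique (hFi i)
    simpa using congrArg (fun f => f v) h1
  -- Equality of mixed second derivatives yields the symmetry of the weights without comparing the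
  -- two parametrizations of an interface.
  have hJsymm (i j : Fin N) : ModLaguerre.kantorovicJacobian D s ν ψ i j =
      ModLaguerre.kantorovicJacobian D s ν ψ j i := by
    have h1 := (innerSL ℝ (E := EuclideanSpace ℝ (Fin N))).hasFDerivAt.comp ψ hdiff.hasFDerivAt
    have h2 := second_derivative_symmetric_of_eventually (f := ModLaguerre.kantorovic D s ν)
      (Filter.Eventually.of_forall fun φ => (hgrad φ).differentiableAt.hasGradientAt.hasFDerivAt)
      h1 (EuclideanSpace.single j 1) (EuclideanSpace.single i 1)
    have h3 : inner ℝ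
        (fderiv ℝ (ModLaguerre.kantorovicGrad D s ν) ψ (EuclideanSpace.single j 1))
        (EuclideanSpace.single i (1 : ℝ)) =
      inner ℝ (fderiv ℝ (ModLaguerre.kantorovicGrad D s ν) ψ (EuclideanSpace.single i 1))
        (EuclideanSpace.single j (1 : ℝ)) := h2
    simpa [ModLaguerre.kantorovicJacobian, EuclideanSpace.inner_single_right] using h3
  have hentry (i j : Fin N) : (-ModLaguerre.kantorovicJacobian D s ν ψ) i j =
      (if i = j then ∑ a, w i a else 0) - w i (some j) := by
    simp only [Matrix.neg_apply, ModLaguerre.kantorovicJacobian, Matrix.of_apply, hJ, neg_neg,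
      mul_sub, Finset.sum_sub_distrib, ← Finset.sum_mul, Fintype.sum_option]
    by_cases h : i = j
    · simp [h]
    · simp [h]
  have hwsymm (i j : Fin N) : w i (some j) = w j (some i) := by
    by_cases h : i = j
    · rw [h]
    · have h1 := hentry i j
      have h2 := hentry j i
      rw [if_neg h] at h1
      rw [if_neg (Ne.symm h)] at h2
      rw [Matrix.neg_apply] at h1 h2
      linarith [hJsymm i j]
  have hpos : (-ModLaguerre.kantorovicJacobian D s ν ψ).PosDef :=
    ModLaguerre.posDef_of_weights hwnonneg hwsymm
      (fun S hS => hG.exists_weight_ne_zero hD hs hwpos hS) hentry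
  refine ⟨Filter.Eventually.of_forall fun φ => (hgrad φ).differentiableAt, hdiff, hpos, ?_⟩
  simpa using hpos.isUnit
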